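/- Let $T>0$, let $L\ge 1$ be an integer, and put $U=[0,T)\times[0,\tfrac1{TL})$. For $\Gamma\subseteq\{0,\dots,L-1\}^2$ let $M_\Gamma=\bigcup_{(k,m)\in\Gamma}\bigl(U+(kT,\tfrac m{TL})\bigr)$. An operator $H$ with spreading function $s_H\in L^2(\mathbb R^2)$ acts on a tempered distribution $x$ by $Hx=\iint s_H(\tau,\nu)\,M_\nu T_\tau x\,d\nu\,d\tau$ (weakly), where $(T_\tau x)(t)=x(t-\tau)$ and $(M_\nu x)(t)=e^{2\pi i\nu t}x(t)$; its norm is $\|H\|=\|s_H\|_{L^2(\mathbb R^2)}$. Let $\mathcal H_{M_\Gamma}$ be the space of operators whose spreading function vanishes a.e. outside $M_\Gamma$, and let $\mathcal X(\Delta)=\bigcup_{\mathrm{area}(M_\Gamma)\le\Delta}\mathcal H_{M_\Gamma}$. A signal $x$ stably identifies a set $\mathcal Q$ of operators if there are constants $0<\alpha\le\beta<\infty$ with $\alpha\|H_1-H_2\|\le\|H_1x-H_2x\|_{L^2(\mathbb R)}\le\beta\|H_1-H_2\|$ for all $H_1,H_2\in\mathcal Q$ (the responses being in $L^2(\mathbb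 R)$); it stably identifies a single operator $H$ in $\mathcal Q$ if there are such constants, which may depend on $H$, for $H_1=H$ and all $H_2\in\mathcal Q$. A property holds for almost all $H\in\mathcal X(\Delta)$ if, for each $\Gamma$ with $\mathrm{area}(M_\Gamma)\le\Delta$, the set of $H\in\mathcal H_{M_\Gamma}$ without it is shy (Haar null) and nowhere dense in $\mathcal H_{M_\Gamma}$. Write $s_{k,m}(t,f)=s_H(t+kT,f+\tfrac m{TL})\,e^{2\pi i(f+m/(TL))t}$ for $(t,f)\in U$. For $c\in\mathbb C^{\mathbb Z/L}$ let $A_c$ be the $L\times L^2$ matrix whose column with index $(k,m)$ has the entries $\tfrac1{TL}c_{k-p}e^{2\pi i pm/L}$, $0\le p<L$, and let $A_\Gamma$ consist of its columns with index in $\Gamma$. For $y\in L^2(\mathbb R)$ let $\mathcal Z_y(t,f)=\sum_{m\in\mathbb Z}y(t-mTL)e^{2\pi i mTLf}$ be its Zak transform ($L^2$-convergence on $[0,TL)\times[0,\tfrac1{TL})$), let $z(t,f)\in\mathbb C^L$ have the entries $\mathcal Z_y(t+pT,f)e^{-2\pi i pTf}$, $0\le p<L$, and let $Z=\int_U z(t,f)z(t,f)^H\,d(t,f)$.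 **Theorem.** Let $\Delta<1$. There is $c\in\mathbb C^{\mathbb Z/L}$ such that the Dirac train $x=\sum_{k\in\mathbb Z}c_k\,\delta(\cdot+kT)$ has the following properties. 1. Almost all $H\in\mathcal X(\Delta)$ are stably identified in $\mathcal X(\Delta)$ by $x$. Moreover, there are sets $\mathcal Q_1\subseteq\mathcal Q_2\subseteq\dots\subseteq\mathcal X(\Delta)$, each stably identified by $x$, whose union contains almost all $H\in\mathcal X(\Delta)$; and $x$ stably identifies $\mathcal H_{M_\Gamma}$ for each $\Gamma$ with $\mathrm{area}(M_\Gamma)\le\Delta$. 2. Almost all $H\in\mathcal X(\Delta)$ lie in some $\mathcal H_{M_\Gamma}$ with $\mathrm{area}(M_\Gamma)\le\Delta$ for which the functions $s_{k,m}$, $(k,m)\in\Gamma$, are linearly independent on $U$ (up to null sets). 3. Every $H$ as in 2 is stably identified in $\mathcal X(\Delta)$ by $x$ and is recovered from $y=Hx$ as follows. If the columns of $U_n$ span the null space of $Z$, then $\Gamma$ is the set of indices of the zero columns of $U_n^HA_c$. The matrix $A_\Gamma$ has full column rank, and for almost every $(t,f)\in U$ the vector $(s_{k,m}(t,f))_{(k,m)\in\Gamma}$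 is the unique solution $v$ of $A_\Gamma v=z(t,f)$. -/

import Mathlib

open MeasureTheory Filter Topology
open scoped SchwartzMap ENNReal ComplexConjugate Matrix Pointwise

noncomputable section

namespace OperatorId

/-! ### Signals and operators -/

/-- The translation operator `(T_τ x)(t) = x(t - τ)` on tempered distributions:
`⟨T_τ x, φ⟩ = ⟨x, φ(· + τ)⟩`. -/
def translation (τ : ℝ) : 𝓢'(ℝ, ℂ) →L[ℂ] 𝓢'(ℝ, ℂ) :=
  PointwiseConvergenceCLM.precomp ℂ (SchwartzMap.compSubConstCLM ℂ (-τ))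

/-- The pure tone `t ↦ e^{j2πνt}`. -/
def tone (ν : ℝ) : ℝ → ℂ := fun t => Complex.exp (2 * Real.pi * Complex.I * ν * t)

/-- The modulation operator `(M_ν x)(t) = e^{j2πνt} x(t)` on tempered distributions. -/
def modulation (ν : ℝ) : 𝓢'(ℝ, ℂ) →L[ℂ] 𝓢'(ℝ, ℂ) :=
  TemperedDistribution.smulLeftCLM ℂ (tone ν)

theorem norm_tone (ν t : ℝ) : ‖tone ν t‖ = 1 := by
  have : tone ν t = Complex.exp (((2 * Real.pi * ν * t : ℝ) : ℂ) * Complex.I) := by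
    unfold tone; congr 1; push_cast; ring
  rw [this, Complex.norm_exp_ofReal_mul_I]

theorem tone_iteratedDeriv (ν : ℝ) (n : ℕ) :
    iteratedDeriv n (tone ν) = fun t => (2 * Real.pi * Complex.I * ν) ^ n * tone ν t := by
  induction n with
  | zero => simp
  | succ n ih =>
    rw [iteratedDeriv_succ, ih]
    funext t
    have h1 : HasDerivAt (fun t : ℝ => 2 * Real.pi * Complex.I * ν * (t : ℂ))
        (2 * Real.pi * Complex.I * ν) t := by
      simpa using (Complex.ofRealCLM.hasDerivAt (x := t)).const_mul (2 * Real.pi * Complex.I * ν)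
    have h2 : HasDerivAt (tone ν) (tone ν t * (2 * Real.pi * Complex.I * ν)) t := h1.cexp
    rw [(h2.const_mul _).deriv]
    ring

/-- Tones have temperate growth, so `modulation` is the genuine multiplication operator. -/
theorem tone_hasTemperateGrowth (ν : ℝ) : (tone ν).HasTemperateGrowth := by
  refine ⟨?_, fun n => ⟨0, ‖(2 * Real.pi * Complex.I * ν : ℂ)‖ ^ n, fun t => ?_⟩⟩
  · unfold tone
    have : ContDiff ℝ (⊤ : ℕ∞) (fun t : ℝ => (t : ℂ)) := Complex.ofRealCLM.contDiff
    fun_prop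
  · rw [norm_iteratedFDeriv_eq_norm_iteratedDeriv, tone_iteratedDeriv]
    simp [norm_tone]

theorem modulation_translation_apply (ν τ : ℝ) (x : 𝓢'(ℝ, ℂ)) (φ : 𝓢(ℝ, ℂ)) :
    modulation ν (translation τ x) φ =
      x (SchwartzMap.compSubConstCLM ℂ (-τ) (SchwartzMap.smulLeftCLM ℂ (tone ν) φ)) := rfl

/-- The linear space of operators. An operator
`H x = ∫∫ s(τ, ν) M_ν T_τ x dν dτ` is given by its spreading function `s ∈ L²(ℝ²)`, and the inner
product and the norm of operators are those of the spreading functions. -/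
abbrev Op : Type := Lp ℂ 2 (volume : Measure (ℝ × ℝ))

/-- `y ∈ L²(ℝ)` is the response `H x` of the operator with spreading function `H` to the
(generalized) signal `x`: the identity `y = ∫∫ H(τ, ν) M_ν T_τ x dν dτ` holds in the weak sense,
i.e. when both sides are paired with an arbitrary Schwartz function. -/
def IsResponse (H : Op) (x : 𝓢'(ℝ, ℂ)) (y : Lp ℂ 2 (volume : Measure ℝ)) : Prop :=
  ∀ φ : 𝓢(ℝ, ℂ),
    Integrable (fun p : ℝ × ℝ => H p * modulation p.2 (translation p.1 x) φ) ∧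
      ∫ t, y t * φ t = ∫ p : ℝ × ℝ, H p * modulation p.2 (translation p.1 x) φ

/-- The responses `H₁ x`, `H₂ x` are in `L²(ℝ)` and
`α ‖H₁ - H₂‖ ≤ ‖H₁ x - H₂ x‖ ≤ β ‖H₁ - H₂‖`. -/
def StabilityBounds (x : 𝓢'(ℝ, ℂ)) (α β : ℝ) (H₁ H₂ : Op) : Prop :=
  ∃ y₁ y₂ : Lp ℂ 2 (volume : Measure ℝ), IsResponse H₁ x y₁ ∧ IsResponse H₂ x y₂ ∧
    α * ‖H₁ - H₂‖ ≤ ‖y₁ - y₂‖ ∧ ‖y₁ - y₂‖ ≤ β * ‖H₁ - H₂‖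

/-- `x` stably identifies the set `Q` of operators. -/
def StablyIdentifies (x : 𝓢'(ℝ, ℂ)) (Q : Set Op) : Prop :=
  ∃ α β : ℝ, 0 < α ∧ α ≤ β ∧ ∀ H₁ ∈ Q, ∀ H₂ ∈ Q, StabilityBounds x α β H₁ H₂

/-- `x` stably identifies the single operator `H` among all operators in `Q`. -/
def StablyIdentifiesIn (x : 𝓢'(ℝ, ℂ)) (Q : Set Op) (H : Op) : Prop :=
  ∃ α β : ℝ, 0 < α ∧ α ≤ β ∧ ∀ H' ∈ Q, StabilityBounds x α β H H'

/-! ### Support regions and operator classes -/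

/-- The fundamental cell `U = [0, T) × [0, 1/(TL))`. -/
def cell (T : ℝ) (L : ℕ) : Set (ℝ × ℝ) := Set.Ico 0 T ×ˢ Set.Ico 0 (1 / (T * L))

/-- The region `M_Γ`, the union of the cells `U + (kT, m/(TL))`, `(k, m) ∈ Γ`. -/
def region (T : ℝ) (L : ℕ) (Γ : Finset (Fin L × Fin L)) : Set (ℝ × ℝ) :=
  ⋃ i ∈ Γ, ((i.1 : ℝ) * T, (i.2 : ℝ) / (T * L)) +ᵥ cell T L

/-- The area of `M_Γ`. -/
def area (T : ℝ) (L : ℕ) (Γ : Finset (Fin L × Fin L)) : ℝ := volume.real (region T L Γ)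

/-- The operators whose spreading function is supported in `M_Γ`. -/
def opClass (T : ℝ) (L : ℕ) (Γ : Finset (Fin L × Fin L)) : Submodule ℂ Op where
  carrier := {H | ∀ᵐ p : ℝ × ℝ, p ∉ region T L Γ → H p = 0}
  zero_mem' := by
    filter_upwards [Lp.coeFn_zero ℂ 2 (volume : Measure (ℝ × ℝ))] with p hp _
    rw [hp]; rfl
  add_mem' := by
    intro a b ha hb
    filter_upwards [ha, hb, Lp.coeFn_add a b] with p h1 h2 h3 hp
    rw [h3, Pi.add_apply, h1 hp, h2 hp, add_zero]
  smul_mem' := by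
    intro c a ha
    filter_upwards [ha, Lp.coeFn_smul c a] with p h1 h3 hp
    rw [h3, Pi.smul_apply, h1 hp, smul_zero]

/-- `X(Δ)`, the operators whose spreading function is supported in some `M_Γ` of area at
most `Δ`. -/
def blindClass (T : ℝ) (L : ℕ) (Δ : ℝ) : Set Op :=
  ⋃ (Γ : Finset (Fin L × Fin L)) (_ : area T L Γ ≤ Δ), (opClass T L Γ : Set Op)

/-! ### Almost all operators -/

/-- Shy (Haar null) subsets of a normed space, the standard translation invariant substitute for
Lebesgue null sets in infinite dimension: `E` is contained in a Borel set all of whose translates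
are null for one and the same Borel measure that is positive and finite on some compact set. -/
def IsShy {V : Type*} [NormedAddCommGroup V] (E : Set V) : Prop :=
  letI : MeasurableSpace V := borel V
  ∃ B : Set V, E ⊆ B ∧ MeasurableSet B ∧ ∃ μ : Measure V,
    (∃ K : Set V, IsCompact K ∧ 0 < μ K ∧ μ K < ∞) ∧ ∀ v : V, μ (v +ᵥ B) = 0

/-- Almost all operators of `X(Δ)` lie in `P`: in each of the finitely many Hilbert spaces of
which `X(Δ)` is the union, the set of operators outside `P` is shy and nowhere dense. -/
def AlmostAll (T : ℝ) (L : ℕ) (Δ : ℝ) (P : Set Op) : Prop :=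
  ∀ Γ : Finset (Fin L × Fin L), area T L Γ ≤ Δ →
    IsShy {H : opClass T L Γ | (H : Op) ∉ P} ∧
      IsNowhereDense {H : opClass T L Γ | (H : Op) ∉ P}

/-! ### The probing signal -/

/-- The weighted `TL`-periodic train of Dirac impulses `∑_k c_k δ(t + kT)`, as a sum in the space
of tempered distributions. -/
def diracTrain (T : ℝ) {L : ℕ} (c : ZMod L → ℂ) : 𝓢'(ℝ, ℂ) :=
  ∑' k : ℤ, c (k : ZMod L) • TemperedDistribution.delta (-((k : ℝ) * T))

theorem summable_train {T : ℝ} (hT : 0 < T) :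
    Summable fun k : ℤ => ((1 + |(k : ℝ) * T|) ^ 2)⁻¹ := by
  have h : Summable fun k : ℤ => (T ^ 2)⁻¹ * (1 / (k : ℝ) ^ 2) :=
    (Real.summable_one_div_int_pow.2 (by norm_num)).mul_left _
  refine Summable.of_norm_bounded_eventually h ?_
  have h0 : ∀ᶠ k : ℤ in cofinite, k ≠ 0 := by
    simpa using (Set.finite_singleton (0 : ℤ)).eventually_cofinite_notMem
  filter_upwards [h0] with k hk
  have hk' : (0 : ℝ) < (k : ℝ) ^ 2 := by positivity
  rw [Real.norm_of_nonneg (by positivity), one_div, ← mul_inv]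
  apply inv_anti₀ (by positivity)
  have : T ^ 2 * (k : ℝ) ^ 2 = |(k : ℝ) * T| ^ 2 := by rw [sq_abs]; ring
  rw [this]
  gcongr
  linarith

/-- The series defining the Dirac train converges. -/
theorem hasSum_diracTrain {T : ℝ} (hT : 0 < T) {L : ℕ} [NeZero L] (c : ZMod L → ℂ) :
    HasSum (fun k : ℤ => c (k : ZMod L) •
      (TemperedDistribution.delta (-((k : ℝ) * T)) : 𝓢'(ℝ, ℂ))) (diracTrain T c) := by
  obtain ⟨C, hC0, hC⟩ : ∃ C : ℝ, 0 ≤ C ∧ ∀ k, ‖c k‖ ≤ C :=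
    ⟨∑ k, ‖c k‖, Finset.sum_nonneg fun _ _ => norm_nonneg _,
      fun k => Finset.single_le_sum (f := fun k => ‖c k‖) (fun _ _ => norm_nonneg _)
        (Finset.mem_univ k)⟩
  have hb : ∀ (f : 𝓢(ℝ, ℂ)) (k : ℤ), ‖c (k : ZMod L) * f (-((k : ℝ) * T))‖ ≤
      ((1 + |(k : ℝ) * T|) ^ 2)⁻¹ * (C * (2 ^ 2 *
        (Finset.Iic ((2, 0) : ℕ × ℕ)).sup (schwartzSeminormFamily ℂ ℝ ℂ) f)) := by
    intro f k
    have h := SchwartzMap.one_add_le_sup_seminorm_apply (𝕜 := ℂ) (m := (2, 0)) (k := 2) (n := 0)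
      le_rfl le_rfl f (-((k : ℝ) * T))
    simp only [norm_iteratedFDeriv_zero, Real.norm_eq_abs, abs_neg] at h
    rw [norm_mul, ← div_eq_inv_mul, le_div_iff₀' (by positivity)]
    calc (1 + |(k : ℝ) * T|) ^ 2 * (‖c (k : ZMod L)‖ * ‖f (-((k : ℝ) * T))‖)
        = ‖c (k : ZMod L)‖ * ((1 + |(k : ℝ) * T|) ^ 2 * ‖f (-((k : ℝ) * T))‖) := by ring
      _ ≤ _ := mul_le_mul (hC _) h (by positivity) hC0
  have hs : ∀ f : 𝓢(ℝ, ℂ), Summable fun k : ℤ => c (k : ZMod L) * f (-((k : ℝ) * T)) :=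
    fun f => Summable.of_norm_bounded ((summable_train hT).mul_right _) (hb f)
  let A : 𝓢(ℝ, ℂ) →L[ℂ] ℂ := SchwartzMap.mkCLMtoNormedSpace
    (fun f => ∑' k : ℤ, c (k : ZMod L) * f (-((k : ℝ) * T)))
    (fun f g => by
      rw [← (hs f).tsum_add (hs g)]
      exact tsum_congr fun k => by simp [mul_add])
    (fun a f => by
      rw [RingHom.id_apply, smul_eq_mul, ← tsum_mul_left]
      exact tsum_congr fun k => by simp [mul_left_comm])
    ⟨Finset.Iic (2, 0), (∑' k : ℤ, ((1 + |(k : ℝ) * T|) ^ 2)⁻¹) * (C * 2 ^ 2), by positivity,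
      fun f => by
        refine (tsum_of_norm_bounded ((summable_train hT).mul_right _).hasSum (hb f)).trans ?_
        rw [tsum_mul_right]
        apply le_of_eq; ring⟩
  have key : HasSum (fun k : ℤ => c (k : ZMod L) •
      (TemperedDistribution.delta (-((k : ℝ) * T)) : 𝓢'(ℝ, ℂ)))
      (ContinuousLinearMap.toPointwiseConvergenceCLM _ _ _ _ A : 𝓢'(ℝ, ℂ)) := by
    refine (PointwiseConvergenceCLM.tendsto_iff_forall_tendsto).2 fun f => ?_
    have := (hs f).hasSum
    refine Tendsto.congr (fun s => ?_) this
    simp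
  exact key.summable.hasSum

theorem diracTrain_apply {T : ℝ} (hT : 0 < T) {L : ℕ} [NeZero L] (c : ZMod L → ℂ)
    (φ : 𝓢(ℝ, ℂ)) :
    HasSum (fun k : ℤ => c (k : ZMod L) * φ (-((k : ℝ) * T))) (diracTrain T c φ) := by
  have h := (PointwiseConvergenceCLM.tendsto_iff_forall_tendsto).1 (hasSum_diracTrain hT c) φ
  refine Tendsto.congr (fun s => ?_) h
  simp

/-! ### The recovery algorithm -/

/-- The cell components `s_{k,m}(t, f) = s(t + kT, f + m/(TL)) e^{j2π(f + m/(TL))t}`. -/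
def cellComponent (T : ℝ) (L : ℕ) (H : Op) (i : Fin L × Fin L) (u : ℝ × ℝ) : ℂ :=
  H (u.1 + (i.1 : ℝ) * T, u.2 + (i.2 : ℝ) / (T * L)) * tone (u.2 + (i.2 : ℝ) / (T * L)) u.1

/-- The functions `s_{k,m}`, `(k, m) ∈ Γ`, are linearly independent on the fundamental cell. -/
def CellsIndependent (T : ℝ) (L : ℕ) (Γ : Finset (Fin L × Fin L)) (H : Op) : Prop :=
  ∀ a : Fin L × Fin L → ℂ,
    (∀ᵐ u ∂(volume.restrict (cell T L)), ∑ i ∈ Γ, conj (a i) * cellComponent T L H i u = 0) →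
      ∀ i ∈ Γ, a i = 0

/-- `ζ` is the Zak transform (with parameter `P`) of `y ∈ L²(ℝ)` on `[0, P) × [0, 1/P)`: the series
`∑_m y(t - mP) e^{j2πmPf}` converges to `ζ(t, f)` in `L²`. -/
def IsZakTransform (P : ℝ) (y : Lp ℂ 2 (volume : Measure ℝ)) (ζ : ℝ × ℝ → ℂ) : Prop :=
  MemLp ζ 2 (volume.restrict (Set.Ico 0 P ×ˢ Set.Ico 0 (1 / P))) ∧
    Tendsto (fun N : ℕ => eLpNorm
      (fun u : ℝ × ℝ => ζ u -
        ∑ m ∈ Finset.Icc (-(N : ℤ)) N, y (u.1 - (m : ℝ) * P) * tone ((m : ℝ) * P) u.2)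
      2 (volume.restrict (Set.Ico 0 P ×ˢ Set.Ico 0 (1 / P)))) atTop (𝓝 0)

/-- The vector `z(t, f)` with entries `ζ(t + pT, f) e^{-j2πpTf}`, where `ζ` is a Zak transform. -/
def zakVector (T : ℝ) (L : ℕ) (ζ : ℝ × ℝ → ℂ) (u : ℝ × ℝ) : Fin L → ℂ :=
  fun p => ζ (u.1 + (p : ℝ) * T, u.2) * tone (-((p : ℝ) * T)) u.2

/-- The correlation matrix `Z = ∫_U z(t, f) z(t, f)ᴴ d(t, f)`. -/
def correlationMatrix (T : ℝ) (L : ℕ) (ζ : ℝ × ℝ → ℂ) : Matrix (Fin L) (Fin L) ℂ :=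
  Matrix.of fun p q => ∫ u in cell T L, zakVector T L ζ u p * conj (zakVector T L ζ u q)

/-- The `L × L²` matrix `A_c` whose column with index `(k, m)` has the entries
`(TL)⁻¹ c_{k-p} e^{j2πpm/L}`, `p = 0, …, L - 1`. -/
def trainMatrix (T : ℝ) {L : ℕ} (c : ZMod L → ℂ) : Matrix (Fin L) (Fin L × Fin L) ℂ :=
  Matrix.of fun p i => (1 / (T * L) : ℂ) * c (((i.1 : ℕ) : ZMod L) - ((p : ℕ) : ZMod L)) *
    Complex.exp (2 * Real.pi * Complex.I * (p : ℕ) * (i.2 : ℕ) / L)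

/-- The submatrix `A_Γ` of the columns of `A_c` with indices in `Γ`. -/
def activeMatrix (T : ℝ) {L : ℕ} (c : ZMod L → ℂ) (Γ : Finset (Fin L × Fin L)) :
    Matrix (Fin L) Γ ℂ :=
  (trainMatrix T c).submatrix id Subtype.val

/-- The support set found from `ζ` is `Γ`: whenever the columns of `Un` span the null space of the
correlation matrix, the zero columns of `Unᴴ A_c` are exactly those with index in `Γ`. -/
def SupportRecovered (T : ℝ) {L : ℕ} (c : ZMod L → ℂ) (ζ : ℝ × ℝ → ℂ)
    (Γ : Finset (Fin L × Fin L)) : Prop :=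
  ∀ (r : ℕ) (Un : Matrix (Fin L) (Fin r) ℂ),
    Submodule.span ℂ (Set.range Un.col) =
        LinearMap.ker (Matrix.mulVecLin (correlationMatrix T L ζ)) →
      ∀ i : Fin L × Fin L, (Unᴴ * trainMatrix T c).col i = 0 ↔ i ∈ Γ

/-- `A_Γ` has full column rank and, at almost every point of the fundamental cell, the components
`s_{k,m}`, `(k, m) ∈ Γ`, of the spreading function form the unique solution of the linear
system `A_Γ v = z`. -/
def SpreadingRecovered (T : ℝ) {L : ℕ} (c : ZMod L → ℂ) (ζ : ℝ × ℝ → ℂ)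
    (Γ : Finset (Fin L × Fin L)) (H : Op) : Prop :=
  (activeMatrix T c Γ).rank = Γ.card ∧
    ∀ᵐ u ∂(volume.restrict (cell T L)), ∀ v : Γ → ℂ,
      activeMatrix T c Γ *ᵥ v = zakVector T L ζ u ↔ v = fun i : Γ => cellComponent T L H i.1 u

end OperatorId

end

open OperatorId

open MeasureTheory Filter Topology
open scoped SchwartzMap ENNReal ComplexConjugate Matrix Pointwise

noncomputable section

namespace OperatorId

/-! The Zak transform with parameter `T * L` turns the response to a Dirac train into
finite-dimensional linear algebra. Cut the spreading function into its `L ^ 2` cells and transport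
them to `U`. An impulse that arrives in the `n`-th period contributes a Fourier integral over
frequency, and its weights depend only on `n` modulo `L`. Collecting the residues gives `z = A_c s`
at almost every point of `U`, where the matrix `A_c` is constant and `s` is the vector of all
components. By Plancherel the norm of the response is a constant times the norm of `A_c s`
(`exists_response`). All questions are thus about the columns of `A_c`.

The train is chosen so that any `L` of the `L ^ 2` columns are independent
(`exists_trainMatrix_linearIndependent`). With `c_j = t ^ (j ^ 2)`, each `L × L` minor is, up to a
nonzero factor and the order of its rows and columns, a polynomial in `t`. Its terms of least degree
come from the assignments of rows to columns of least quadratic cost on a circle. A rotation given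
by a cycle lemma makes the monotone assignment optimal, and the only others of the same cost permute
columns with equal translation index. The least coefficient is therefore a block Vandermonde
determinant, which is not zero. A value of `t` that avoids the finitely many roots of all these
polynomials works for every minor at once.

Each cell has area `1 / L`, so area below one means fewer than `L` active cells. For a known
support, functionals dual to the active columns give the lower stability bound. Suppose that `H` has
independent components on `Γ`, and that a competitor's support `Γ'` misses some `j` in `Γ`. The
columns in `Γ'` together with column `j` are at most `L`, so a functional kills the former and is
one on the latter. Applied to the difference of the Zak data, it yields a nonzero vector that
depends only on `H` and `Γ'`; so the data stay a definite distance apart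
(`exists_norm_sub_le_zakMap`). The same functional separates inactive columns from the span of the
active ones in the subspace method for the support: the null space of the correlation matrix is the
orthogonal complement of that span.

Independence of the components is generic because it is an open condition, and adding a multiple of
an operator with orthogonal nonzero components destroys it only for finitely many multiples, the
eigenvalues of a matrix. -/

/-! ### Linear independence of the columns of `A_c` -/

/-- A cycle lemma: after a suitable rotation of the circle `ZMod L`, for every `n` at most `n` of
`L` given points lie in the first `n` positions. -/
theorem exists_rotation_card_le {L : ℕ} [NeZero L] (K : Fin L → ZMod L) :
    ∃ s : ZMod L, ∀ n ≤ L, (Finset.univ.filter fun q => (K q - s).val < n).card ≤ n := by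
  classical
  let l : ℕ → ℤ := fun i => ((Finset.univ.filter fun q => K q = (i : ZMod L)).card : ℤ)
  -- A walk that rises by the number of points at each position and falls by one. It is periodic
  -- because there are as many points as positions.
  let N : ℕ → ℤ := fun x => ∑ i ∈ Finset.range x, (l i - 1)
  have hcard : ∀ s n : ℕ, n ≤ L →
      ((Finset.univ.filter fun q => (K q - (s : ZMod L)).val < n).card : ℤ)
        = ∑ i ∈ Finset.range n, l (s + i) := by
    intro s n hn
    have hu : (Finset.univ.filter fun q => (K q - (s : ZMod L)).val < n)
        = (Finset.range n).biUnion
            fun i => Finset.univ.filter fun q => K q = ((s + i : ℕ) : ZMod L) := by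
      ext q
      simp only [Finset.mem_filter, Finset.mem_univ, true_and, Finset.mem_biUnion,
        Finset.mem_range]
      constructor
      · intro h
        refine ⟨_, h, ?_⟩
        push_cast
        rw [ZMod.natCast_val, ZMod.cast_id]
        ring
      · rintro ⟨i, hi, h⟩
        rw [h]
        push_cast
        rw [add_sub_cancel_left, ZMod.val_natCast, Nat.mod_eq_of_lt (by omega)]
        exact hi
    rw [hu, Finset.card_biUnion]
    · rw [Nat.cast_sum]
    · intro i hi j hj hij
      rw [Function.onFun, Finset.disjoint_left]
      intro q h1 h2
      simp only [Finset.mem_filter, Finset.mem_univ, true_and] at h1 h2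
      rw [h1] at h2
      push_cast at h2
      have h3 := add_left_cancel h2
      rw [ZMod.natCast_eq_natCast_iff'] at h3
      simp only [Finset.coe_range, Set.mem_Iio] at hi hj
      rw [Nat.mod_eq_of_lt (by omega), Nat.mod_eq_of_lt (by omega)] at h3
      exact hij h3
  have hNadd : ∀ s n, N (s + n) = N s + ∑ i ∈ Finset.range n, l (s + i) - n := by
    intro s n
    simp only [N]
    rw [Finset.sum_range_add, Finset.sum_sub_distrib (f := fun i => l (s + i))]
    simp
    ring
  have hper : ∀ s, N (s + L) = N s := by
    intro s
    rw [hNadd, ← hcard s L le_rfl, Finset.filter_true_of_mem fun q _ => ZMod.val_lt _]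
    simp
  -- From a maximum of the walk it can only descend, which says that no initial segment is overfull.
  obtain ⟨s, -, hs⟩ := Finset.exists_max_image (Finset.range L) N
    ⟨0, Finset.mem_range.2 (NeZero.pos L)⟩
  have hmax : ∀ x, N x ≤ N s := by
    intro x
    have : N x = N (x % L) := by
      conv_lhs => rw [← Nat.mod_add_div x L]
      generalize x / L = d
      induction d with
      | zero => simp
      | succ d ih => rw [Nat.mul_succ, ← add_assoc, hper, ih]
    rw [this]
    exact hs _ (Finset.mem_range.2 (Nat.mod_lt _ (NeZero.pos L)))
  refine ⟨s, fun n hn => ?_⟩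
  have h1 := hNadd s n
  have h2 := hmax (s + n)
  rw [← hcard s n hn] at h1
  have : ((Finset.univ.filter fun q => (K q - (s : ZMod L)).val < n).card : ℤ) ≤ n := by linarith
  exact_mod_cast this

/-- A monotone tuple is dominated by every monotone tuple that dominates one of its
rearrangements. -/
theorem le_of_monotone_of_le_comp_perm {n : ℕ} {κ b : Fin n → ℕ} (hκ : Monotone κ)
    (hb : Monotone b) (ρ : Equiv.Perm (Fin n)) (h : ∀ p, κ (ρ p) ≤ b p) (p : Fin n) :
    κ p ≤ b p := by
  -- Pigeonhole: the `p + 1` indices up to `p` cannot all be mapped below `p`.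
  obtain ⟨q, hq, hpq⟩ : ∃ q ≤ p, p ≤ ρ q := by
    by_contra hcon
    push Not at hcon
    have hsub : (Finset.Iic p).map ρ.toEmbedding ⊆ Finset.Iio p := by
      intro x hx
      obtain ⟨q, hq, rfl⟩ := Finset.mem_map.1 hx
      exact Finset.mem_Iio.2 (hcon q (Finset.mem_Iic.1 hq))
    have := Finset.card_le_card hsub
    simp at this
  exact (hκ hpq).trans ((h q).trans (hb hq))

/-- Among all ways to move the points `0, …, L - 1` of a circle of length `L` forward to the
positions `κ`, the monotone one is the only one of least quadratic cost, if it does not go around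
the circle. -/
theorem sum_sq_forward_distance {L : ℕ} {κ : Fin L → ℕ} (hκ : Monotone κ)
    (hκL : ∀ p, κ p < L) (hle : ∀ p : Fin L, (p : ℕ) ≤ κ p) (σ : Equiv.Perm (Fin L))
    (hσ : ∑ p : Fin L, ((κ (σ p) + L - p) % L) ^ 2 ≤ ∑ p : Fin L, ((κ p + L - p) % L) ^ 2) :
    ∀ p, κ (σ p) = κ p := by
  -- The end point of the move on the unrolled line: `κ (σ p)`, or that plus `L` if the move goes
  -- around the circle.
  let a : Fin L → ℕ := fun p => p + (κ (σ p) + L - p) % L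
  have hκa : ∀ p, κ (σ p) ≤ a p := by
    intro p
    have h1 := hκL (σ p)
    have hp := p.2
    by_cases h : (p : ℕ) ≤ κ (σ p)
    · have : (κ (σ p) + L - p) % L = κ (σ p) - p := by
        rw [show κ (σ p) + L - p = (κ (σ p) - p) + L by omega, Nat.add_mod_right,
          Nat.mod_eq_of_lt (by omega)]
      simp only [a]
      omega
    · simp only [a]
      omega
  have hid : ∀ p : Fin L, (κ p + L - p) % L = κ p - p := by
    intro p
    have h1 := hκL p
    have h2 := hle p
    rw [show κ p + L - p = (κ p - p) + L by omega, Nat.add_mod_right,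
      Nat.mod_eq_of_lt (by omega)]
  let τ := Tuple.sort a
  have hτ : Monotone (a ∘ τ) := Tuple.monotone_sort a
  have hdom : ∀ p, κ p ≤ a (τ p) :=
    le_of_monotone_of_le_comp_perm hκ hτ (τ.trans σ) fun p => hκa (τ p)
  have hmono : Monovary (fun p : Fin L => ((p : ℕ) : ℤ)) (fun p => (a (τ p) : ℤ)) := by
    intro i j hij
    by_contra hcon
    push Not at hcon
    have h1 : j ≤ i := by
      have : (j : ℕ) < i := by exact_mod_cast hcon
      exact Fin.le_def.2 this.le
    have := hτ h1
    have h2 : a (τ i) < a (τ j) := Int.ofNat_lt.1 hij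
    simp only [Function.comp_apply] at this
    omega
  have hre : ∑ p : Fin L, ((p : ℕ) : ℤ) * (a p : ℤ) ≤
      ∑ p : Fin L, ((p : ℕ) : ℤ) * (a (τ p) : ℤ) := by
    have := hmono.sum_mul_comp_perm_le_sum_mul (σ := τ⁻¹)
    simpa using this
  have hsq : ∑ p, (a (τ p) : ℤ) ^ 2 = ∑ p, (a p : ℤ) ^ 2 :=
    Equiv.sum_comp τ fun p => (a p : ℤ) ^ 2
  have hcost : ∑ p : Fin L, ((a p : ℤ) - ((p : ℕ) : ℤ)) ^ 2
      ≤ ∑ p : Fin L, ((κ p : ℤ) - ((p : ℕ) : ℤ)) ^ 2 := by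
    have e1 : ∀ p : Fin L, ((a p : ℤ) - ((p : ℕ) : ℤ)) ^ 2
        = (((κ (σ p) + L - p) % L) ^ 2 : ℕ) := by
      intro p
      simp only [a]
      push_cast
      ring
    have e2 : ∀ p : Fin L, ((κ p : ℤ) - ((p : ℕ) : ℤ)) ^ 2
        = (((κ p + L - p) % L) ^ 2 : ℕ) := by
      intro p
      rw [hid, Nat.cast_pow, Nat.cast_sub (hle p)]
    rw [Finset.sum_congr rfl fun p _ => e1 p, Finset.sum_congr rfl fun p _ => e2 p]
    exact_mod_cast hσ
  -- The squares of the `a p` and of the `p` have the same sums on both sides, so the rearrangement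
  -- inequality for the mixed term decides.
  have hexp : ∑ p : Fin L, ((a (τ p) : ℤ) - ((p : ℕ) : ℤ)) ^ 2
      ≤ ∑ p : Fin L, ((a p : ℤ) - ((p : ℕ) : ℤ)) ^ 2 := by
    have e : ∀ x y : ℤ, (x - y) ^ 2 = x ^ 2 - 2 * (y * x) + y ^ 2 := fun x y => by ring
    simp only [e, Finset.sum_add_distrib, Finset.sum_sub_distrib, ← Finset.mul_sum]
    linarith
  have hpt : ∀ p : Fin L, ((κ p : ℤ) - ((p : ℕ) : ℤ)) ^ 2
      ≤ ((a (τ p) : ℤ) - ((p : ℕ) : ℤ)) ^ 2 := by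
    intro p
    have h1 : (κ p : ℤ) ≤ a (τ p) := by exact_mod_cast hdom p
    have h2 : ((p : ℕ) : ℤ) ≤ κ p := by exact_mod_cast hle p
    apply pow_le_pow_left₀ <;> linarith
  -- The costs satisfy `κ ≤ a ∘ τ ≤ a ≤ κ`, hence all agree, and the first comparison holds
  -- termwise.
  have heq := (Finset.sum_eq_sum_iff_of_le fun p (_ : p ∈ Finset.univ) => hpt p).1
    (le_antisymm (Finset.sum_le_sum fun p _ => hpt p) (hexp.trans hcost))
  have haτ : ∀ p, a (τ p) = κ p := by
    intro p
    have h1 : (κ p : ℤ) ≤ a (τ p) := by exact_mod_cast hdom p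
    have h2 : ((p : ℕ) : ℤ) ≤ κ p := by exact_mod_cast hle p
    have h3 := (pow_left_inj₀ (by linarith) (by linarith) two_ne_zero).1 (heq p (Finset.mem_univ p))
    have : (a (τ p) : ℤ) = κ p := by linarith
    exact_mod_cast this
  have hsum : ∑ p, κ (σ p) = ∑ p, a p := by
    rw [Equiv.sum_comp σ κ, ← Equiv.sum_comp τ a]
    exact Finset.sum_congr rfl fun p _ => (haτ p).symm
  have haσ : ∀ p, κ (σ p) = a p := fun p =>
    (Finset.sum_eq_sum_iff_of_le fun p (_ : p ∈ Finset.univ) => hκa p).1 hsum p (Finset.mem_univ p)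
  have hre' : ∑ p : Fin L, ((p : ℕ) : ℤ) * (a p : ℤ) =
      ∑ p : Fin L, ((p : ℕ) : ℤ) * (a (τ p) : ℤ) := by
    refine le_antisymm hre ?_
    have h1 := Finset.sum_le_sum fun p (_ : p ∈ Finset.univ) => hpt p
    have e : ∀ x y : ℤ, (x - y) ^ 2 = x ^ 2 - 2 * (y * x) + y ^ 2 := fun x y => by ring
    have h2 := h1.trans' hcost
    simp only [e, Finset.sum_add_distrib, Finset.sum_sub_distrib, ← Finset.mul_sum] at h2
    linarith
  -- The equality case of the rearrangement inequality: `a` was sorted already.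
  have hamono : Monotone a := by
    have h1 := (hmono.sum_mul_comp_perm_eq_sum_mul_iff (σ := τ⁻¹)).1 (by simpa using hre')
    intro i j hij
    by_contra hcon
    push Not at hcon
    have h2 := h1 (i := j) (j := i) (by simpa using hcon)
    have h3 : (j : ℕ) ≤ i := Int.ofNat_le.1 h2
    have : i = j := le_antisymm hij (Fin.le_def.2 h3)
    subst this
    exact lt_irrefl _ hcon
  have hu := Tuple.unique_monotone (f := κ) (σ := σ) (τ := 1)
    (by rwa [show κ ∘ σ = a from funext haσ]) (by simpa using hκ)
  exact fun p => congrFun hu p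

/-- The vanishing power sums extend by linearity to all polynomials of degree below `B.card`. The
Lagrange polynomial that vanishes at every node but `x q` isolates `u q`. -/
theorem eq_zero_of_forall_sum_pow_mul_eq_zero {ι F : Type*} [Field F] (B : Finset ι)
    {x u : ι → F} (hx : Set.InjOn x B) (h : ∀ j < B.card, ∑ q ∈ B, x q ^ j * u q = 0) :
    ∀ q ∈ B, u q = 0 := by
  classical
  intro q hq
  let P : Polynomial F := ∏ r ∈ B.erase q, (Polynomial.X - Polynomial.C (x r))
  have hdeg : P.natDegree < B.card := by
    simp only [P]
    rw [Polynomial.natDegree_prod_of_monic _ _ fun i _ => Polynomial.monic_X_sub_C _]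
    simp only [Polynomial.natDegree_X_sub_C, Finset.sum_const, smul_eq_mul, mul_one]
    exact Finset.card_erase_lt_of_mem hq
  have h0 : ∑ r ∈ B, P.eval (x r) * u r = 0 := by
    simp only [Polynomial.eval_eq_sum_range' hdeg, Finset.sum_mul]
    rw [Finset.sum_comm]
    refine Finset.sum_eq_zero fun j hj => ?_
    simp only [mul_assoc]
    rw [← Finset.mul_sum, h j (Finset.mem_range.1 hj), mul_zero]
  rw [Finset.sum_eq_single_of_mem q hq] at h0
  · refine (mul_eq_zero.1 h0).resolve_left ?_
    simp only [P, Polynomial.eval_prod, Polynomial.eval_sub, Polynomial.eval_X, Polynomial.eval_C]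
    refine Finset.prod_ne_zero_iff.2 fun r hr => sub_ne_zero.2 fun hxr => ?_
    exact Finset.ne_of_mem_erase hr (hx (Finset.mem_of_mem_erase hr) hq hxr.symm)
  · intro r hr hrq
    have : P.eval (x r) = 0 := by
      simp only [P, Polynomial.eval_prod]
      exact Finset.prod_eq_zero (Finset.mem_erase.2 ⟨hrq, hr⟩) (by simp)
    rw [this, zero_mul]

/-- The block diagonal matrix of the Vandermonde blocks with consecutive exponents is
nonsingular. -/
theorem det_block_vandermonde_ne_zero {L : ℕ} {κ : Fin L → ℕ} (hκ : Monotone κ) (s : ℕ)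
    {x : Fin L → ℂ} (hx0 : ∀ q, x q ≠ 0) (hx : ∀ q r, κ q = κ r → x q = x r → q = r) :
    (Matrix.of fun p q : Fin L => if κ q = κ p then x q ^ ((p : ℕ) + s) else 0).det ≠ 0 := by
  classical
  intro hdet
  obtain ⟨v, hv0, hv⟩ := Matrix.exists_mulVec_eq_zero_iff.2 hdet
  apply hv0
  funext q₀
  let B : Finset (Fin L) := Finset.univ.filter fun q => κ q = κ q₀
  have hq₀ : q₀ ∈ B := by simp [B]
  let a := B.min' ⟨q₀, hq₀⟩
  let b := B.max' ⟨q₀, hq₀⟩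
  have ha : κ a = κ q₀ := (Finset.mem_filter.1 (B.min'_mem ⟨q₀, hq₀⟩)).2
  have hb : κ b = κ q₀ := (Finset.mem_filter.1 (B.max'_mem ⟨q₀, hq₀⟩)).2
  -- Rows between `a` and `b` belong to the same block, since `κ` is monotone. Hence there are at
  -- least `B.card` consecutive exponents, starting at `a + s`, for the Vandermonde argument.
  have hB : B ⊆ Finset.Icc a b := fun q hq =>
    Finset.mem_Icc.2 ⟨B.min'_le q hq, B.le_max' q hq⟩
  have hcard := Finset.card_le_card hB
  rw [Fin.card_Icc] at hcard
  have hab : (a : ℕ) ≤ b := Fin.le_def.1 (B.min'_le b (B.max'_mem ⟨q₀, hq₀⟩))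
  have key := eq_zero_of_forall_sum_pow_mul_eq_zero B (x := x)
    (u := fun q => x q ^ ((a : ℕ) + s) * v q)
    (fun q hq r hr h => hx q r (by
      rw [(Finset.mem_filter.1 hq).2, (Finset.mem_filter.1 hr).2]) h)
    (by
      intro j hj
      have hlt : (a : ℕ) + j < L := by have := b.2; omega
      let p : Fin L := ⟨a + j, hlt⟩
      have hp : κ p = κ q₀ := by
        apply le_antisymm
        · rw [← hb]
          refine hκ (Fin.le_def.2 ?_)
          change (a : ℕ) + j ≤ b
          omega
        · rw [← ha]
          refine hκ (Fin.le_def.2 ?_)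
          change (a : ℕ) ≤ a + j
          omega
      have h1 := congrFun hv p
      simp only [Matrix.mulVec, dotProduct, Matrix.of_apply, ite_mul, zero_mul, Pi.zero_apply]
        at h1
      rw [hp, ← Finset.sum_filter] at h1
      rw [← h1]
      refine Finset.sum_congr rfl fun q _ => ?_
      rw [← mul_assoc, ← pow_add]
      congr 2
      change j + ((a : ℕ) + s) = a + j + s
      ring)
    q₀ hq₀
  exact (mul_eq_zero.1 key).resolve_left (pow_ne_zero _ (hx0 _))

/-- For all but finitely many values of the parameter `t`, the determinant of the matrix with the
entries `t ^ d(p, q)² x_q ^ (p + s)` does not vanish, where `d(p, q)` is the distance from `p`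
forward to the position `κ q` on a circle of length `L`. -/
theorem exists_polynomial_det {L : ℕ} {κ : Fin L → ℕ} (hκ : Monotone κ)
    (hκL : ∀ p, κ p < L) (hle : ∀ p : Fin L, (p : ℕ) ≤ κ p) (s : ℕ)
    {x : Fin L → ℂ} (hx0 : ∀ q, x q ≠ 0) (hx : ∀ q r, κ q = κ r → x q = x r → q = r) :
    ∃ D : Polynomial ℂ, D ≠ 0 ∧ ∀ t : ℂ, D.eval t =
      (Matrix.of fun p q : Fin L =>
        t ^ (((κ q + L - p) % L) ^ 2) * x q ^ ((p : ℕ) + s)).det := by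
  classical
  let M : Matrix (Fin L) (Fin L) (Polynomial ℂ) := Matrix.of fun p q : Fin L =>
    Polynomial.C (x q ^ ((p : ℕ) + s)) * Polynomial.X ^ (((κ q + L - p) % L) ^ 2)
  refine ⟨M.det, ?_, ?_⟩
  · let W : ℕ := ∑ p : Fin L, ((κ p + L - p) % L) ^ 2
    -- Each permutation contributes one monomial to the Leibniz formula, with its cost as exponent.
    -- By `sum_sq_forward_distance` the cost is `W` exactly for those that preserve `κ`, which are
    -- the ones that survive in the block diagonal matrix.
    have hco : M.det.coeff W =
        (Matrix.of fun p q : Fin L => if κ q = κ p then x q ^ ((p : ℕ) + s) else 0).det := by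
      rw [← Matrix.det_transpose, Matrix.det_apply', ← Matrix.det_transpose (Matrix.of _),
        Matrix.det_apply', Polynomial.finsetSum_coeff]
      refine Finset.sum_congr rfl fun σ _ => ?_
      rw [Polynomial.coeff_intCast_mul]
      congr 1
      simp only [Matrix.transpose_apply, M, Matrix.of_apply]
      rw [Finset.prod_mul_distrib, ← map_prod, Finset.prod_pow_eq_pow_sum,
        Polynomial.coeff_C_mul_X_pow]
      split_ifs with h
      · have := sum_sq_forward_distance hκ hκL hle σ h.ge
        exact Finset.prod_congr rfl fun p _ => by rw [if_pos (this p)]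
      · symm
        by_contra hne
        apply h
        have : ∀ p, κ (σ p) = κ p := by
          intro p
          by_contra hp
          exact hne (Finset.prod_eq_zero (Finset.mem_univ p) (if_neg hp))
        exact Finset.sum_congr rfl fun p _ => by rw [this p]
    intro h0
    exact det_block_vandermonde_ne_zero hκ s hx0 hx (by rw [← hco, h0, Polynomial.coeff_zero])
  · intro t
    rw [← Polynomial.coe_evalRingHom, RingHom.map_det]
    congr 1
    ext p q
    simp [M, mul_comm]

/-- There is `c` such that any `L` columns of `A_c` are linearly independent. -/
theorem exists_trainMatrix_linearIndependent {T : ℝ} (hT : 0 < T) (L : ℕ) [NeZero L] :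
    ∃ c : ZMod L → ℂ, ∀ Λ : Finset (Fin L × Fin L), Λ.card ≤ L →
      LinearIndependent ℂ fun i : Λ => (trainMatrix T c).col i.1 := by
  classical
  have hL : (L : ℂ) ≠ 0 := by exact_mod_cast NeZero.ne L
  let ω : ℂ := Complex.exp (2 * Real.pi * Complex.I / L)
  have hω : IsPrimitiveRoot ω L := Complex.isPrimitiveRoot_exp L (NeZero.ne L)
  have main : ∀ Λ : Finset (Fin L × Fin L), Λ.card = L → ∃ D : Polynomial ℂ, D ≠ 0 ∧
      ∀ t : ℂ, D.eval t ≠ 0 → LinearIndependent ℂ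
        fun i : Λ => (trainMatrix T fun j : ZMod L => t ^ (j.val ^ 2)).col i.1 := by
    intro Λ hΛ
    let e₀ : Fin L ≃ Λ := (Λ.equivFinOfCardEq hΛ).symm
    obtain ⟨s, hs⟩ := exists_rotation_card_le fun q => (((e₀ q).1.1 : ℕ) : ZMod L)
    let κ₀ : Fin L → ℕ := fun q => ((((e₀ q).1.1 : ℕ) : ZMod L) - s).val
    let e : Fin L ≃ Λ := (Tuple.sort κ₀).trans e₀
    let κ : Fin L → ℕ := fun q => ((((e q).1.1 : ℕ) : ZMod L) - s).val
    -- After the rotation by `s` and sorting, the cycle lemma says that `p ≤ κ p`: otherwise `p + 1`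
    -- points would lie in the first `p` positions.
    have hκ : Monotone κ := Tuple.monotone_sort κ₀
    have hκL : ∀ q, κ q < L := fun q => ZMod.val_lt _
    have hle : ∀ p : Fin L, (p : ℕ) ≤ κ p := by
      intro p
      by_contra hcon
      push Not at hcon
      have h1 : ((Finset.Iic p).map (Tuple.sort κ₀).toEmbedding) ⊆
          Finset.univ.filter fun q => ((((e₀ q).1.1 : ℕ) : ZMod L) - s).val < p := by
        intro r hr
        obtain ⟨q, hq, rfl⟩ := Finset.mem_map.1 hr
        exact Finset.mem_filter.2
          ⟨Finset.mem_univ _, lt_of_le_of_lt (hκ (Finset.mem_Iic.1 hq)) hcon⟩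
      have h2 := (Finset.card_le_card h1).trans (hs p p.2.le)
      simp at h2
    let x : Fin L → ℂ := fun q => ω ^ ((e q).1.2 : ℕ)
    have hx0 : ∀ q, x q ≠ 0 := fun q => pow_ne_zero _ (Complex.exp_ne_zero _)
    have hx : ∀ q r, κ q = κ r → x q = x r → q = r := by
      intro q r h1 h2
      have h3 : (((e q).1.1 : ℕ) : ZMod L) = (((e r).1.1 : ℕ) : ZMod L) :=
        sub_left_injective (ZMod.val_injective L h1)
      rw [ZMod.natCast_eq_natCast_iff', Nat.mod_eq_of_lt (Fin.is_lt _),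
        Nat.mod_eq_of_lt (Fin.is_lt _)] at h3
      have h4 := hω.pow_inj (Fin.is_lt _) (Fin.is_lt _) h2
      exact e.injective (Subtype.ext (Prod.ext (Fin.ext h3) (Fin.ext h4)))
    obtain ⟨D, hD0, hD⟩ := exists_polynomial_det hκ hκL hle s.val hx0 hx
    refine ⟨D, hD0, fun t ht => ?_⟩
    rw [hD] at ht
    rw [Fintype.linearIndependent_iff]
    intro g hg
    have hmv : (Matrix.of fun p q : Fin L =>
        t ^ (((κ q + L - p) % L) ^ 2) * x q ^ ((p : ℕ) + s.val)) *ᵥ (fun q => g (e q)) = 0 := by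
      funext p
      -- The rotation of the columns is compensated by rotating the rows. The exponent may then stay
      -- `p + s` without reduction, since the `x q` are `L`-th roots of unity.
      let r : Fin L := ⟨(p + s.val) % L, Nat.mod_lt _ (NeZero.pos L)⟩
      have h1 := congrFun hg r
      rw [Finset.sum_apply, ← Equiv.sum_comp e] at h1
      have hc : (1 / (T * L) : ℂ) ≠ 0 := by
        refine one_div_ne_zero (mul_ne_zero ?_ hL)
        exact_mod_cast hT.ne'
      refine (mul_eq_zero.1 (?_ : (1 / (T * L) : ℂ) * _ = 0)).resolve_left hc
      rw [Pi.zero_apply] at h1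
      rw [← h1, Matrix.mulVec, dotProduct, Finset.mul_sum]
      refine Finset.sum_congr rfl fun q _ => ?_
      have hval : (((((e q).1.1 : ℕ) : ZMod L) - ((r : ℕ) : ZMod L))).val
          = (κ q + L - p) % L := by
        have : ((((e q).1.1 : ℕ) : ZMod L) - ((r : ℕ) : ZMod L))
            = ((κ q + L - p : ℕ) : ZMod L) := by
          rw [Nat.cast_sub (by have := p.2; omega)]
          simp only [r, κ, ZMod.natCast_mod]
          push_cast
          simp only [ZMod.natCast_val, ZMod.cast_id', id, ZMod.natCast_self]
          ring
        rw [this, ZMod.val_natCast]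
      have hexp : Complex.exp (2 * Real.pi * Complex.I * (r : ℕ) * ((e q).1.2 : ℕ) / L)
          = x q ^ ((p : ℕ) + s.val) := by
        have h5 : Complex.exp (2 * Real.pi * Complex.I * (r : ℕ) * ((e q).1.2 : ℕ) / L)
            = ω ^ ((r : ℕ) * ((e q).1.2 : ℕ)) := by
          rw [← Complex.exp_nat_mul]
          congr 1
          push_cast
          ring
        rw [h5, mul_comm, pow_mul]
        change (x q) ^ ((p + s.val) % L) = _
        have h6 : x q ^ L = 1 := by
          simp only [x]
          rw [← pow_mul, mul_comm, pow_mul, hω.pow_eq_one, one_pow]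
        conv_rhs => rw [← Nat.mod_add_div ((p : ℕ) + s.val) L, pow_add, pow_mul, h6, one_pow,
          mul_one]
      simp only [Matrix.of_apply, Pi.smul_apply, Matrix.col_apply, trainMatrix, smul_eq_mul]
      rw [hval, hexp]
      ring
    have hz : (fun q => g (e q)) = 0 := by
      by_contra hne
      exact ht (Matrix.exists_mulVec_eq_zero_iff.1 ⟨_, hne, hmv⟩)
    intro i
    have := congrFun hz (e.symm i)
    simpa using this
  choose! D hD0 hD using main
  let S := (Finset.univ : Finset (Finset (Fin L × Fin L))).filter fun Λ => Λ.card = L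
  have hP : (∏ Λ ∈ S, D Λ) ≠ 0 :=
    Finset.prod_ne_zero_iff.2 fun Λ hΛ => hD0 Λ (Finset.mem_filter.1 hΛ).2
  -- One parameter for all minors: a nonzero polynomial over an infinite field has a point where it
  -- does not vanish.
  obtain ⟨t, ht⟩ : ∃ t : ℂ, (∏ Λ ∈ S, D Λ).eval t ≠ 0 := by
    by_contra hcon
    push Not at hcon
    exact hP (Polynomial.funext fun t => by rw [hcon t, Polynomial.eval_zero])
  refine ⟨fun j => t ^ (j.val ^ 2), fun Λ hΛ => ?_⟩
  obtain ⟨Λ', hsub, hcard⟩ := Finset.exists_superset_card_eq hΛ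
    (by simpa using Nat.le_mul_of_pos_left L (NeZero.pos L))
  rw [Polynomial.eval_prod, Finset.prod_ne_zero_iff] at ht
  have := hD Λ' hcard t (ht Λ' (Finset.mem_filter.2 ⟨Finset.mem_univ _, hcard⟩))
  exact this.comp (fun i : Λ => (⟨i.1, hsub i.2⟩ : Λ'))
    fun i j h => Subtype.ext (by simpa using h)

/-! ### The components of an operator as elements of `L²` of the fundamental cell -/

theorem eLpNorm_two_sq {α F : Type*} [MeasurableSpace α] [NormedAddCommGroup F] (f : α → F)
    (μ : Measure α) : eLpNorm f 2 μ ^ 2 = ∫⁻ x, ‖f x‖ₑ ^ 2 ∂μ := by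
  have := eLpNorm_nnreal_pow_eq_lintegral (f := f) (μ := μ) (p := 2) two_ne_zero
  simpa using this

theorem enorm_lp_sq {α F : Type*} [MeasurableSpace α] [NormedAddCommGroup F] {μ : Measure α}
    (f : Lp F 2 μ) : ‖f‖ₑ ^ 2 = ∫⁻ x, ‖f x‖ₑ ^ 2 ∂μ := by
  rw [Lp.enorm_def, eLpNorm_two_sq]

theorem norm_sq_of_enorm_sq {F ι : Type*} {E : ι → Type*} [NormedAddCommGroup F]
    [∀ i, NormedAddCommGroup (E i)] (s : Finset ι) (f : F) (g : ∀ i, E i)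
    (h : ‖f‖ₑ ^ 2 = ∑ i ∈ s, ‖g i‖ₑ ^ 2) : ‖f‖ ^ 2 = ∑ i ∈ s, ‖g i‖ ^ 2 := by
  have := congrArg ENNReal.toReal h
  rw [ENNReal.toReal_sum fun i _ => by simp] at this
  simpa using this

variable {T : ℝ} {L : ℕ}

/-- The position `(kT, m/(TL))` of the cell with index `(k, m)`. -/
def corner (T : ℝ) (L : ℕ) (i : Fin L × Fin L) : ℝ × ℝ :=
  ((i.1 : ℝ) * T, (i.2 : ℝ) / (T * L))

theorem measurableSet_cell : MeasurableSet (cell T L) := measurableSet_Ico.prod measurableSet_Ico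

theorem volume_cell (hT : 0 < T) [NeZero L] : volume (cell T L) = ENNReal.ofReal (1 / L) := by
  have hL : (0 : ℝ) < L := by exact_mod_cast NeZero.pos L
  rw [cell, Measure.volume_eq_prod, Measure.prod_prod, Real.volume_Ico, Real.volume_Ico,
    ← ENNReal.ofReal_mul (by linarith)]
  congr 1
  field_simp
  simp

theorem volume_cell_lt_top : volume (cell T L) < ∞ := by
  rw [cell, Measure.volume_eq_prod, Measure.prod_prod, Real.volume_Ico, Real.volume_Ico]
  exact ENNReal.mul_lt_top ENNReal.ofReal_lt_top ENNReal.ofReal_lt_top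

theorem mem_cell_vadd {a u : ℝ × ℝ} : u ∈ a +ᵥ cell T L ↔ u - a ∈ cell T L := by
  rw [Set.mem_vadd_set_iff_neg_vadd_mem, vadd_eq_add, neg_add_eq_sub]

theorem natCast_eq_of_add_mul_mem_Ico {r x y : ℝ} {k l : ℕ} (hx : x ∈ Set.Ico 0 r)
    (hy : y ∈ Set.Ico 0 r) (h : x + k * r = y + l * r) : k = l ∧ x = y := by
  have hr : 0 < r := hx.1.trans_lt hx.2
  have h1 : (k : ℝ) < l + 1 := by
    by_contra hc
    push Not at hc
    nlinarith [hx.1, hy.2]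
  have h2 : (l : ℝ) < k + 1 := by
    by_contra hc
    push Not at hc
    nlinarith [hy.1, hx.2]
  have h3 : k < l + 1 := by exact_mod_cast h1
  have h4 : l < k + 1 := by exact_mod_cast h2
  have h5 : k = l := by omega
  subst h5
  exact ⟨rfl, by linarith⟩

theorem eq_of_add_corner_eq {u w : ℝ × ℝ} {i j : Fin L × Fin L} (hu : u ∈ cell T L)
    (hw : w ∈ cell T L) (h : u + corner T L i = w + corner T L j) : i = j := by
  have h1 := congrArg Prod.fst h
  have h2 := congrArg Prod.snd h
  simp only [corner, Prod.fst_add, Prod.snd_add] at h1 h2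
  refine Prod.ext (Fin.ext (natCast_eq_of_add_mul_mem_Ico hu.1 hw.1 h1).1)
    (Fin.ext (natCast_eq_of_add_mul_mem_Ico hu.2 hw.2 ?_).1)
  simpa [div_eq_mul_inv] using h2

theorem add_corner_mem_region_iff {Γ : Finset (Fin L × Fin L)} {u : ℝ × ℝ} (hu : u ∈ cell T L)
    (i : Fin L × Fin L) : u + corner T L i ∈ region T L Γ ↔ i ∈ Γ := by
  simp only [region, Set.mem_iUnion, mem_cell_vadd]
  constructor
  · rintro ⟨j, hj, h⟩
    have : i = j := eq_of_add_corner_eq hu h (sub_add_cancel _ (corner T L j)).symm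
    rwa [this]
  · exact fun hi => ⟨i, hi, by change u + corner T L i - corner T L i ∈ _; simpa using hu⟩

theorem pairwise_disjoint_cells (Γ : Finset (Fin L × Fin L)) :
    Set.PairwiseDisjoint (Γ : Set (Fin L × Fin L)) fun i => corner T L i +ᵥ cell T L := by
  intro i _ j _ hij
  rw [Function.onFun, Set.disjoint_left]
  intro u hu hw
  rw [mem_cell_vadd] at hu hw
  exact hij (eq_of_add_corner_eq hu hw (by simp))

theorem measurableSet_cell_vadd (a : ℝ × ℝ) : MeasurableSet (a +ᵥ cell T L) :=
  measurableSet_cell.const_vadd a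

theorem measurableSet_region (Γ : Finset (Fin L × Fin L)) : MeasurableSet (region T L Γ) :=
  Finset.measurableSet_biUnion _ fun _ _ => measurableSet_cell_vadd _

/-- The cells are disjoint and each has area `1 / L`. This is how `Δ < 1` enters; the strict
inequality leaves room for one more column. -/
theorem card_lt_of_area_le (hT : 0 < T) [NeZero L] {Δ : ℝ} (hΔ : Δ < 1)
    {Γ : Finset (Fin L × Fin L)} (h : area T L Γ ≤ Δ) : Γ.card < L := by
  have hL : (0 : ℝ) < L := by exact_mod_cast NeZero.pos L
  have hv : area T L Γ = Γ.card * (1 / L) := by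
    have hr : region T L Γ = ⋃ i ∈ Γ, corner T L i +ᵥ cell T L := rfl
    rw [area, Measure.real, hr, measure_biUnion_finset (pairwise_disjoint_cells Γ)
      fun _ _ => measurableSet_cell_vadd _]
    simp only [measure_vadd, volume_cell hT, Finset.sum_const, nsmul_eq_mul, ENNReal.toReal_mul,
      ENNReal.toReal_natCast]
    rw [ENNReal.toReal_ofReal (by positivity)]
  have h1 : (Γ.card : ℝ) * (1 / L) < 1 := by linarith
  rw [mul_one_div, div_lt_one hL] at h1
  exact_mod_cast h1

theorem measurePreserving_add_corner (i : Fin L × Fin L) :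
    MeasurePreserving (fun u : ℝ × ℝ => u + corner T L i) volume volume :=
  measurePreserving_add_right volume _

theorem continuous_tone_uncurry : Continuous fun p : ℝ × ℝ => tone p.1 p.2 := by
  unfold tone
  fun_prop

theorem enorm_tone (ν t : ℝ) : ‖tone ν t‖ₑ = 1 := by
  rw [← ofReal_norm, norm_tone, ENNReal.ofReal_one]

theorem tone_add (a b x : ℝ) : tone (a + b) x = tone a x * tone b x := by
  unfold tone
  rw [← Complex.exp_add]
  congr 1
  push_cast
  ring

theorem tone_apply_add (a x y : ℝ) : tone a (x + y) = tone a x * tone a y := by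
  unfold tone
  rw [← Complex.exp_add]
  congr 1
  push_cast
  ring

theorem tone_zero (x : ℝ) : tone 0 x = 1 := by simp [tone]

theorem tone_comm (a x : ℝ) : tone a x = tone x a := by
  unfold tone
  congr 1
  ring

theorem cellComponent_eq (H : Op) (i : Fin L × Fin L) (u : ℝ × ℝ) :
    cellComponent T L H i u = H (u + corner T L i) * tone (u.2 + (corner T L i).2) u.1 := rfl

theorem aestronglyMeasurable_cellComponent (H : Op) (i : Fin L × Fin L) :
    AEStronglyMeasurable (cellComponent T L H i) volume := by
  refine ((Lp.aestronglyMeasurable H).comp_measurePreserving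
    (measurePreserving_add_corner i)).mul ?_
  refine Continuous.aestronglyMeasurable ?_
  exact continuous_tone_uncurry.comp (by fun_prop : Continuous fun u : ℝ × ℝ =>
    (u.2 + (i.2 : ℝ) / (T * L), u.1))

/-- The phase factor has modulus one, so moving a cell to the origin is isometric. -/
theorem lintegral_cellComponent (H : Op) (i : Fin L × Fin L) :
    ∫⁻ u in cell T L, ‖cellComponent T L H i u‖ₑ ^ 2
      = ∫⁻ p in corner T L i +ᵥ cell T L, ‖H p‖ₑ ^ 2 := by
  have hpre : cell T L
      = (fun u : ℝ × ℝ => u + corner T L i) ⁻¹' (corner T L i +ᵥ cell T L) := by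
    ext u
    rw [Set.mem_preimage, mem_cell_vadd, add_sub_cancel_right]
  have h := (measurePreserving_add_corner (T := T) i).setLIntegral_comp_preimage_emb
    (MeasurableEquiv.addRight (corner T L i)).measurableEmbedding (fun p => ‖H p‖ₑ ^ 2)
    (corner T L i +ᵥ cell T L)
  rw [← hpre] at h
  rw [← h]
  simp only [cellComponent_eq, enorm_mul, enorm_tone, mul_one]

theorem memLp_cellComponent (H : Op) (i : Fin L × Fin L) :
    MemLp (cellComponent T L H i) 2 (volume.restrict (cell T L)) := by
  refine ⟨(aestronglyMeasurable_cellComponent H i).restrict, ?_⟩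
  have h1 : eLpNorm (cellComponent T L H i) 2 (volume.restrict (cell T L)) ^ 2 < ∞ := by
    rw [eLpNorm_two_sq, lintegral_cellComponent]
    refine (setLIntegral_le_lintegral _ _).trans_lt ?_
    rw [← enorm_lp_sq]
    simp
  by_contra h
  rw [not_lt, top_le_iff] at h
  rw [h] at h1
  simp at h1

/-- The component of an operator in the cell with index `i`, transported to the fundamental
cell. -/
def cellMap (T : ℝ) (L : ℕ) (i : Fin L × Fin L) :
    Op →L[ℂ] Lp ℂ 2 (volume.restrict (cell T L)) :=
  LinearMap.mkContinuous
    { toFun := fun H => (memLp_cellComponent H i).toLp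
      map_add' := by
        intro H K
        rw [← MemLp.toLp_add]
        apply MemLp.toLp_congr
        refine ae_restrict_of_ae ?_
        have h := (measurePreserving_add_corner (T := T) i).quasiMeasurePreserving.ae
          (Lp.coeFn_add H K)
        filter_upwards [h] with u hu
        rw [Pi.add_apply, cellComponent_eq, cellComponent_eq, cellComponent_eq, hu, Pi.add_apply,
          add_mul]
      map_smul' := by
        intro a H
        rw [RingHom.id_apply, ← MemLp.toLp_const_smul]
        apply MemLp.toLp_congr
        refine ae_restrict_of_ae ?_
        have h := (measurePreserving_add_corner (T := T) i).quasiMeasurePreserving.ae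
          (Lp.coeFn_smul a H)
        filter_upwards [h] with u hu
        rw [Pi.smul_apply, cellComponent_eq, cellComponent_eq, hu, Pi.smul_apply, smul_mul_assoc] }
    1 (by
      intro H
      rw [one_mul, ← enorm_le_iff_norm_le]
      refine (ENNReal.pow_le_pow_left_iff two_ne_zero).1 ?_
      simp only [LinearMap.coe_mk, AddHom.coe_mk]
      rw [Lp.enorm_toLp, eLpNorm_two_sq, lintegral_cellComponent, enorm_lp_sq]
      exact setLIntegral_le_lintegral _ _)

theorem coeFn_cellMap (H : Op) (i : Fin L × Fin L) :
    cellMap T L i H =ᵐ[volume.restrict (cell T L)] cellComponent T L H i :=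
  (memLp_cellComponent H i).coeFn_toLp

theorem enorm_cellMap_sq (H : Op) (i : Fin L × Fin L) :
    ‖cellMap T L i H‖ₑ ^ 2 = ∫⁻ p in corner T L i +ᵥ cell T L, ‖H p‖ₑ ^ 2 := by
  rw [enorm_lp_sq, ← lintegral_cellComponent]
  refine lintegral_congr_ae ?_
  filter_upwards [coeFn_cellMap H i] with u hu
  rw [hu]

theorem norm_sq_eq_sum_cellMap {Γ : Finset (Fin L × Fin L)} {H : Op} (hH : H ∈ opClass T L Γ) :
    ‖H‖ ^ 2 = ∑ i ∈ Γ, ‖cellMap T L i H‖ ^ 2 := by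
  apply norm_sq_of_enorm_sq
  simp only [enorm_cellMap_sq]
  rw [← lintegral_biUnion_finset (pairwise_disjoint_cells Γ)
    (fun _ _ => measurableSet_cell_vadd _), enorm_lp_sq]
  change _ = ∫⁻ p in region T L Γ, ‖H p‖ₑ ^ 2
  rw [← lintegral_indicator (measurableSet_region Γ)]
  refine lintegral_congr_ae ?_
  have hH' : ∀ᵐ p : ℝ × ℝ, p ∉ region T L Γ → H p = 0 := hH
  filter_upwards [hH'] with p hp
  by_cases h : p ∈ region T L Γ
  · rw [Set.indicator_of_mem h]
  · rw [Set.indicator_of_notMem h, hp h]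
    simp

theorem cellMap_eq_zero {Γ : Finset (Fin L × Fin L)} {H : Op} (hH : H ∈ opClass T L Γ)
    {i : Fin L × Fin L} (hi : i ∉ Γ) : cellMap T L i H = 0 := by
  have hH' : ∀ᵐ p : ℝ × ℝ, p ∉ region T L Γ → H p = 0 := hH
  apply Lp.ext
  filter_upwards [coeFn_cellMap H i, Lp.coeFn_zero ℂ 2 (volume.restrict (cell T L)),
    ae_restrict_mem measurableSet_cell,
    ae_restrict_of_ae ((measurePreserving_add_corner (T := T) i).quasiMeasurePreserving.ae hH')]
    with u h1 h2 h3 h4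
  rw [h1, h2, cellComponent_eq, h4 (by rwa [add_corner_mem_region_iff h3]), zero_mul,
    Pi.zero_apply]

theorem opClass_mono {Γ Γ' : Finset (Fin L × Fin L)} (h : Γ ⊆ Γ') :
    opClass T L Γ ≤ opClass T L Γ' := by
  intro H hH
  have hH' : ∀ᵐ p : ℝ × ℝ, p ∉ region T L Γ → H p = 0 := hH
  change ∀ᵐ p : ℝ × ℝ, p ∉ region T L Γ' → H p = 0
  filter_upwards [hH'] with p hp hp'
  exact hp fun hmem => hp' (Set.biUnion_subset_biUnion_left h hmem)

/-! ### Almost all operators have linearly independent components -/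

/-- Passing to classes in `L²` absorbs the null sets; conjugating the coefficients is a bijection
and does not affect independence. -/
theorem cellsIndependent_iff {Γ : Finset (Fin L × Fin L)} {H : Op} :
    CellsIndependent T L Γ H ↔ LinearIndependent ℂ fun i : Γ => cellMap T L i.1 H := by
  classical
  have key : ∀ a : Fin L × Fin L → ℂ,
      (∀ᵐ u ∂(volume.restrict (cell T L)), ∑ i ∈ Γ, a i * cellComponent T L H i u = 0) ↔
        ∑ i ∈ Γ, a i • cellMap T L i H = 0 := by
    intro a
    have h1 : (∑ i ∈ Γ, a i • cellMap T L i H : Lp ℂ 2 (volume.restrict (cell T L)))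
        =ᵐ[volume.restrict (cell T L)] fun u => ∑ i ∈ Γ, a i * cellComponent T L H i u := by
      have h2 : ∀ᵐ u ∂(volume.restrict (cell T L)), ∀ i ∈ Γ,
          (a i • cellMap T L i H : Lp ℂ 2 (volume.restrict (cell T L))) u
            = a i * cellComponent T L H i u := by
        refine (Finset.eventually_all Γ).2 fun i _ => ?_
        filter_upwards [Lp.coeFn_smul (a i) (cellMap T L i H), coeFn_cellMap H i] with u hu hu'
        rw [hu, Pi.smul_apply, hu', smul_eq_mul]
      have h3 := Lp.coeFn_finsetSum Γ fun i => a i • cellMap T L i H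
      filter_upwards [h2, h3] with u hu hu'
      rw [hu', Finset.sum_apply]
      exact Finset.sum_congr rfl hu
    rw [Lp.eq_zero_iff_ae_eq_zero]
    constructor
    · intro h
      filter_upwards [h, h1] with u hu hu'
      rw [hu', hu, Pi.zero_apply]
    · intro h
      filter_upwards [h, h1] with u hu hu'
      rw [← hu', hu, Pi.zero_apply]
  constructor
  · intro h
    have h' := (linearIndepOn_finset_iff (s := Γ) (R := ℂ) (v := fun i => cellMap T L i H)).2 (by
      intro g hg i hi
      have := h (fun i => conj (g i)) (by simpa using (key g).2 hg) i hi
      simpa using this)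
    exact h'
  · intro h a ha i hi
    have h' : LinearIndepOn ℂ (fun i => cellMap T L i H) (Γ : Set (Fin L × Fin L)) := h
    have := linearIndepOn_finset_iff.1 h' (fun i => conj (a i)) ((key _).1 ha) i hi
    simpa using this

/-- Pairing a dependency with each `e i` and dividing by `r i` shows that its coefficient vector
lies in the kernel of `z - M`. Every bad `z` is thus an eigenvalue of one fixed matrix. -/
theorem finite_not_linearIndependent_add_smul {E ι : Type*} [NormedAddCommGroup E]
    [InnerProductSpace ℂ E] [Fintype ι] [DecidableEq ι] (s e : ι → E) (r : ι → ℂ)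
    (hr : ∀ i, r i ≠ 0) (he : ∀ i j, inner ℂ (e i) (e j) = if i = j then r i else 0) :
    {z : ℂ | ¬ LinearIndependent ℂ fun i => s i + z • e i}.Finite := by
  let M : Matrix ι ι ℂ := Matrix.of fun i j => -((r i)⁻¹ * inner ℂ (e i) (s j))
  refine (M.charpoly.roots.toFinset.finite_toSet).subset fun z hz => ?_
  simp only [Finset.mem_coe, Multiset.mem_toFinset]
  rw [Polynomial.mem_roots M.charpoly_monic.ne_zero, Polynomial.IsRoot, Matrix.eval_charpoly]
  simp only [Set.mem_ofPred_eq, Fintype.not_linearIndependent_iff] at hz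
  obtain ⟨g, hg, i₀, hi₀⟩ := hz
  refine Matrix.exists_mulVec_eq_zero_iff.1 ⟨g, fun h => hi₀ (congrFun h i₀), ?_⟩
  funext i
  have h1 := congrArg (fun w => (r i)⁻¹ * inner ℂ (e i) w) hg
  simp only [inner_sum, inner_smul_right, inner_add_right, he, inner_zero_right, mul_zero,
    Finset.mul_sum] at h1
  rw [Pi.zero_apply, ← h1, Matrix.mulVec, dotProduct]
  refine Finset.sum_congr rfl fun j _ => ?_
  rw [Matrix.sub_apply, Matrix.scalar_apply, Matrix.diagonal_apply]
  simp only [M, Matrix.of_apply]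
  split_ifs with h
  · field_simp [hr i]
    ring
  · ring

/-! ### A probe operator with orthogonal components -/

/-- Disjoint pieces of the fundamental cell, one for each index. -/
def subcell (T : ℝ) (L : ℕ) (i : Fin L × Fin L) : Set (ℝ × ℝ) :=
  Set.Ico ((i.1 : ℝ) * (T / L)) (((i.1 : ℝ) + 1) * (T / L)) ×ˢ
    Set.Ico ((i.2 : ℝ) * (1 / (T * L) / L)) (((i.2 : ℝ) + 1) * (1 / (T * L) / L))

theorem measurableSet_subcell (i : Fin L × Fin L) : MeasurableSet (subcell T L i) :=
  measurableSet_Ico.prod measurableSet_Ico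

theorem Ico_mul_div_subset {r : ℝ} (hr : 0 < r) (k : Fin L) :
    Set.Ico ((k : ℝ) * (r / L)) (((k : ℝ) + 1) * (r / L)) ⊆ Set.Ico 0 r := by
  have hL : (0 : ℝ) < L := by exact_mod_cast (Nat.zero_le _).trans_lt k.2
  have hk : (k : ℝ) + 1 ≤ L := by exact_mod_cast k.2
  refine Set.Ico_subset_Ico (by positivity) ?_
  rw [mul_div_assoc', div_le_iff₀ hL]
  nlinarith

theorem subcell_subset_cell (hT : 0 < T) (i : Fin L × Fin L) : subcell T L i ⊆ cell T L := by
  have hL : (0 : ℝ) < L := by exact_mod_cast (Nat.zero_le _).trans_lt i.1.2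
  exact Set.prod_mono (Ico_mul_div_subset hT _) (Ico_mul_div_subset (by positivity) _)

theorem eq_of_mem_Ico_mul {r x : ℝ} {k l : ℕ} (hx : x ∈ Set.Ico ((k : ℝ) * r) ((k + 1) * r))
    (hy : x ∈ Set.Ico ((l : ℝ) * r) ((l + 1) * r)) : k = l :=
  (natCast_eq_of_add_mul_mem_Ico (r := r) (x := x - k * r) (y := x - l * r)
    ⟨by linarith [hx.1], by linarith [hx.2]⟩ ⟨by linarith [hy.1], by linarith [hy.2]⟩
    (by ring)).1

theorem eq_of_mem_subcell {i j : Fin L × Fin L} {u : ℝ × ℝ} (hi : u ∈ subcell T L i)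
    (hj : u ∈ subcell T L j) : i = j :=
  Prod.ext (Fin.ext (eq_of_mem_Ico_mul hi.1 hj.1)) (Fin.ext (eq_of_mem_Ico_mul hi.2 hj.2))

theorem volume_subcell_ne_top (i : Fin L × Fin L) : volume (subcell T L i) ≠ ∞ := by
  rw [subcell, Measure.volume_eq_prod, Measure.prod_prod, Real.volume_Ico, Real.volume_Ico]
  exact (ENNReal.mul_lt_top ENNReal.ofReal_lt_top ENNReal.ofReal_lt_top).ne

theorem volume_subcell_ne_zero (hT : 0 < T) (i : Fin L × Fin L) :
    volume (subcell T L i) ≠ 0 := by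
  have hL : (0 : ℝ) < L := by exact_mod_cast (Nat.zero_le _).trans_lt i.1.2
  have h1 : (0 : ℝ) < T / L := by positivity
  have h2 : (0 : ℝ) < 1 / (T * L) / L := by positivity
  rw [subcell, Measure.volume_eq_prod, Measure.prod_prod, Real.volume_Ico, Real.volume_Ico]
  refine mul_ne_zero ?_ ?_ <;>
  · rw [ne_eq, ENNReal.ofReal_eq_zero, not_le]
    nlinarith

theorem restrict_subcell_ne_top (i : Fin L × Fin L) :
    (volume.restrict (cell T L)) (subcell T L i) ≠ ∞ :=
  ne_top_of_le_ne_top (volume_subcell_ne_top i) (Measure.restrict_apply_le _ _)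

/-- There is an operator whose components are the indicators of the pieces `subcell T L i`. -/
theorem exists_probe (hT : 0 < T) (Γ : Finset (Fin L × Fin L)) :
    ∃ H ∈ opClass T L Γ, ∀ i ∈ Γ, cellMap T L i H =
      indicatorConstLp 2 (measurableSet_subcell i) (restrict_subcell_ne_top i) (1 : ℂ) := by
  classical
  -- The phase is the inverse of the one in `cellComponent`, so that the component becomes a plain
  -- indicator.
  let term : Fin L × Fin L → ℝ × ℝ → ℂ := fun i p =>
    (corner T L i +ᵥ subcell T L i).indicator
      (fun p => tone (-p.2) (p.1 - (corner T L i).1)) p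
  have hmeas : ∀ i, MeasurableSet (corner T L i +ᵥ subcell T L i) :=
    fun i => (measurableSet_subcell i).const_vadd _
  have hterm : ∀ i, MemLp (term i) 2 (volume : Measure (ℝ × ℝ)) := by
    intro i
    refine MemLp.of_le (memLp_indicator_const 2 (hmeas i) (1 : ℂ)
      (Or.inr (by rw [measure_vadd]; exact volume_subcell_ne_top i))) ?_ (ae_of_all _ fun p => ?_)
    · refine AEStronglyMeasurable.indicator ?_ (hmeas i)
      exact (continuous_tone_uncurry.comp (by fun_prop : Continuous fun p : ℝ × ℝ =>
        (-p.2, p.1 - (corner T L i).1))).aestronglyMeasurable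
    · by_cases hp : p ∈ corner T L i +ᵥ subcell T L i
      · simp [term, hp, norm_tone]
      · simp [term, hp]
  have hmem : ∀ {i : Fin L × Fin L} {p : ℝ × ℝ}, p ∈ corner T L i +ᵥ subcell T L i ↔
      p - corner T L i ∈ subcell T L i := by
    intro i p
    rw [Set.mem_vadd_set_iff_neg_vadd_mem, vadd_eq_add, neg_add_eq_sub]
  have hsum : MemLp (fun p => ∑ i ∈ Γ, term i p) 2 (volume : Measure (ℝ × ℝ)) :=
    memLp_finsetSum Γ fun i _ => hterm i
  refine ⟨(hsum.toLp : Op), ?_, fun i hi => ?_⟩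
  · change ∀ᵐ p : ℝ × ℝ, p ∉ region T L Γ → (hsum.toLp : Op) p = 0
    filter_upwards [hsum.coeFn_toLp] with p hp hreg
    rw [hp]
    refine Finset.sum_eq_zero fun i hi => Set.indicator_of_notMem (fun h => hreg ?_) _
    refine Set.mem_biUnion hi ?_
    exact Set.vadd_set_mono (subcell_subset_cell hT i) h
  · apply Lp.ext
    filter_upwards [coeFn_cellMap (hsum.toLp : Op) i, indicatorConstLp_coeFn (p := 2)
      (hs := measurableSet_subcell i) (hμs := restrict_subcell_ne_top i) (c := (1 : ℂ)),
      ae_restrict_mem measurableSet_cell,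
      ae_restrict_of_ae ((measurePreserving_add_corner (T := T) i).quasiMeasurePreserving.ae
        hsum.coeFn_toLp)] with u h1 h2 h3 h4
    rw [h1, h2, cellComponent_eq, h4, Finset.sum_eq_single_of_mem i hi]
    · simp only [term]
      by_cases hu : u ∈ subcell T L i
      · rw [Set.indicator_of_mem hu, Set.indicator_of_mem (hmem.2 (by simpa using hu)),
          Prod.snd_add, Prod.fst_add, add_sub_cancel_right, ← tone_add]
        simp [tone_zero]
      · rw [Set.indicator_of_notMem hu,
          Set.indicator_of_notMem (fun h => hu (by simpa using hmem.1 h)), zero_mul]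
    · intro j _ hji
      refine Set.indicator_of_notMem (fun h => hji ?_) _
      exact (eq_of_add_corner_eq h3 (subcell_subset_cell hT j (hmem.1 h)) (by simp)).symm

/-! ### Shy and nowhere dense sets -/

theorem IsShy.mono {V : Type*} [NormedAddCommGroup V] {E F : Set V} (hF : IsShy F) (h : E ⊆ F) :
    IsShy E := by
  obtain ⟨B, hB, hrest⟩ := hF
  exact ⟨B, h.trans hB, hrest⟩

/-- A closed set that meets all lines in a given direction in finite sets is shy and nowhere
dense. -/
theorem isShy_and_isNowhereDense_of_finite {V : Type*} [NormedAddCommGroup V] [NormedSpace ℝ V]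
    {E : Set V} (hE : IsClosed E) (w : V) (h : ∀ v, {t : ℝ | v + t • w ∈ E}.Finite) :
    IsShy E ∧ IsNowhereDense E := by
  constructor
  · let _ : MeasurableSpace V := borel V
    have : BorelSpace V := ⟨rfl⟩
    have hc : Continuous fun t : ℝ => t • w := by fun_prop
    -- The transverse measure is length on a segment in the direction `w`. Each translate of `E`
    -- meets the line in a finite set, which has length zero.
    refine ⟨E, subset_rfl, hE.measurableSet,
      Measure.map (fun t : ℝ => t • w) (volume.restrict (Set.Icc 0 1)),
      ⟨(fun t : ℝ => t • w) '' Set.Icc 0 1, isCompact_Icc.image hc, ?_, ?_⟩, fun v => ?_⟩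
    · refine lt_of_lt_of_le ?_ (Measure.le_map_apply hc.aemeasurable _)
      rw [Measure.restrict_apply' measurableSet_Icc,
        Set.inter_eq_right.2 (Set.subset_preimage_image _ _)]
      simp
    · rw [Measure.map_apply hc.measurable (isCompact_Icc.image hc).measurableSet]
      exact measure_lt_top _ _
    · rw [Measure.map_apply hc.measurable (hE.vadd v).measurableSet]
      refine measure_mono_null ?_ ((h (-v)).measure_zero _)
      intro t ht
      rw [Set.mem_preimage, Set.mem_vadd_set_iff_neg_vadd_mem] at ht
      exact ht
  · rw [hE.isNowhereDense_iff, Set.eq_empty_iff_forall_notMem]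
    intro v hv
    have hc : Tendsto (fun t : ℝ => v + t • w) (𝓝 0) (𝓝 v) := by
      have : Continuous fun t : ℝ => v + t • w := by fun_prop
      simpa using this.tendsto 0
    -- An interior point would put an interval of parameters into a finite set.
    have hmem : {t : ℝ | v + t • w ∈ E} ∈ 𝓝 (0 : ℝ) := hc (mem_interior_iff_mem_nhds.1 hv)
    exact (infinite_of_mem_nhds 0 hmem) (h v)

theorem almostAll_mono {Δ : ℝ} {P Q : Set Op} (hP : AlmostAll T L Δ P)
    (h : ∀ Γ : Finset (Fin L × Fin L), area T L Γ ≤ Δ → ∀ H ∈ opClass T L Γ, H ∈ P → H ∈ Q) :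
    AlmostAll T L Δ Q := by
  intro Γ hΓ
  have hsub : {H : opClass T L Γ | (H : Op) ∉ Q} ⊆ {H : opClass T L Γ | (H : Op) ∉ P} :=
    fun H hH hp => hH (h Γ hΓ H H.2 hp)
  exact ⟨(hP Γ hΓ).1.mono hsub, (hP Γ hΓ).2.mono hsub⟩

/-- Independence of a finite family is an open condition, so the exceptional set is closed. Lines in
the direction of the probe operator meet it in finite sets. -/
theorem almostAll_cellsIndependent (hT : 0 < T) (Δ : ℝ) :
    AlmostAll T L Δ {H | ∃ Γ : Finset (Fin L × Fin L), area T L Γ ≤ Δ ∧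
      H ∈ opClass T L Γ ∧ CellsIndependent T L Γ H} := by
  classical
  intro Γ hΓ
  let F : opClass T L Γ → Γ → Lp ℂ 2 (volume.restrict (cell T L)) :=
    fun H i => cellMap T L i.1 (H : Op)
  have hF : Continuous F := by
    refine continuous_pi fun i => ?_
    exact (cellMap T L i.1).continuous.comp continuous_subtype_val
  let E : Set (opClass T L Γ) := {H | ¬ LinearIndependent ℂ (F H)}
  have hE : IsClosed E := by
    have : IsOpen (F ⁻¹' {f | LinearIndependent ℂ f}) :=
      isOpen_setOfPred_linearIndependent.preimage hF
    exact this.isClosed_compl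
  have hsub : {H : opClass T L Γ | (H : Op) ∉ {H | ∃ Γ : Finset (Fin L × Fin L),
      area T L Γ ≤ Δ ∧ H ∈ opClass T L Γ ∧ CellsIndependent T L Γ H}} ⊆ E := by
    intro H hH hli
    exact hH ⟨Γ, hΓ, H.2, cellsIndependent_iff.2 hli⟩
  obtain ⟨H₀, hH₀, hprobe⟩ := exists_probe hT Γ
  have hfin : ∀ H : opClass T L Γ, {t : ℝ | H + t • (⟨H₀, hH₀⟩ : opClass T L Γ) ∈ E}.Finite := by
    intro H
    let e : Γ → Lp ℂ 2 (volume.restrict (cell T L)) := fun i =>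
      indicatorConstLp 2 (measurableSet_subcell i.1) (restrict_subcell_ne_top i.1) (1 : ℂ)
    have hfin := finite_not_linearIndependent_add_smul (F H) e
      (fun i => (((volume.restrict (cell T L)).real (subcell T L i.1) : ℝ) : ℂ)) (by
        intro i h
        rw [Complex.ofReal_eq_zero, Measure.real, ENNReal.toReal_eq_zero_iff] at h
        refine h.elim ?_ (restrict_subcell_ne_top i.1)
        rw [Measure.restrict_apply (measurableSet_subcell _),
          Set.inter_eq_left.2 (subcell_subset_cell hT _)]
        exact volume_subcell_ne_zero hT _) (by
        intro i j
        rw [L2.inner_indicatorConstLp_one]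
        rw [setIntegral_congr_ae (g := fun u => (subcell T L j.1).indicator (fun _ => (1 : ℂ)) u)
          (measurableSet_subcell _) (by
            filter_upwards [indicatorConstLp_coeFn (p := 2)
              (hs := measurableSet_subcell j.1) (hμs := restrict_subcell_ne_top j.1)
              (c := (1 : ℂ))] with u hu _
            exact hu)]
        split_ifs with h
        · subst h
          rw [setIntegral_indicator (measurableSet_subcell _), Set.inter_self]
          simp
        · rw [setIntegral_indicator (measurableSet_subcell _)]
          have : subcell T L i.1 ∩ subcell T L j.1 = ∅ := by
            rw [Set.eq_empty_iff_forall_notMem]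
            exact fun u hu => h (Subtype.ext (eq_of_mem_subcell hu.1 hu.2))
          rw [this]
          simp)
    refine (hfin.preimage (f := fun t : ℝ => (t : ℂ))
      (Complex.ofReal_injective.injOn)).subset fun t ht => ?_
    have hFt : F (H + t • (⟨H₀, hH₀⟩ : opClass T L Γ)) = fun i => F H i + (t : ℂ) • e i := by
      funext i
      change cellMap T L i.1 ((H : Op) + (t : ℂ) • H₀) = _
      rw [map_add, map_smul, hprobe i.1 i.2]
    change ¬ LinearIndependent ℂ _ at ht
    rw [hFt] at ht
    exact ht
  obtain ⟨h1, h2⟩ := isShy_and_isNowhereDense_of_finite hE (⟨H₀, hH₀⟩ : opClass T L Γ) hfin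
  exact ⟨h1.mono hsub, h2.mono hsub⟩

/-! ### Inversion of the Zak transform -/

theorem lintegral_eq_tsum_translates {P : ℝ} (hP : 0 < P) (f : ℝ → ℝ≥0∞) :
    ∫⁻ x, f x = ∑' n : ℤ, ∫⁻ t in Set.Ico 0 P, f (t + n * P) := by
  rw [← setLIntegral_univ, ← iUnion_Ico_zsmul hP, lintegral_iUnion (fun _ => measurableSet_Ico)
    (Set.pairwise_disjoint_Ico_zsmul P)]
  refine tsum_congr fun n => ?_
  have h := (measurePreserving_add_right (volume : Measure ℝ)
    (n * P)).setLIntegral_comp_preimage_emb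
    (MeasurableEquiv.addRight (n * P)).measurableEmbedding f (Set.Ico (n • P) ((n + 1) • P))
  rw [← h]
  congr 2
  ext t
  simp only [zsmul_eq_mul, Set.mem_preimage, Set.mem_Ico]
  push_cast
  constructor <;> rintro ⟨h1, h2⟩ <;> constructor <;> linarith

theorem hasSum_integral_translates {P : ℝ} (hP : 0 < P) {f : ℝ → ℂ} (hf : Integrable f) :
    HasSum (fun n : ℤ => ∫ t in Set.Ico 0 P, f (t + n * P)) (∫ x, f x) := by
  have h := hasSum_integral_iUnion (f := f) (μ := volume)
    (s := fun n : ℤ => Set.Ico (n • P) ((n + 1) • P)) (fun _ => measurableSet_Ico)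
    (Set.pairwise_disjoint_Ico_zsmul P) hf.integrableOn
  rw [iUnion_Ico_zsmul hP, setIntegral_univ] at h
  refine h.congr_fun fun n => ?_
  have h := (measurePreserving_add_right (volume : Measure ℝ)
    (n * P)).setIntegral_preimage_emb
    (MeasurableEquiv.addRight (n * P)).measurableEmbedding f (Set.Ico (n • P) ((n + 1) • P))
  rw [← h]
  congr 2
  ext t
  simp only [zsmul_eq_mul, Set.mem_preimage, Set.mem_Ico]
  push_cast
  constructor <;> rintro ⟨h1, h2⟩ <;> constructor <;> linarith

/-- The coefficients of the expansion of `g` into the tones of frequency `mP`, which are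
`1/P`-periodic. -/
def fiberCoeff (P : ℝ) (g : ℝ → ℂ) (m : ℤ) : ℂ :=
  P * ∫ f in Set.Ico 0 (1 / P), g f * tone (-(m * P)) f

/-- Parseval for Fourier series on an interval of length `1 / P`; the factor `P` in `fiberCoeff` is
the normalization of the Fourier coefficients. -/
theorem tsum_enorm_fiberCoeff {P : ℝ} (hP : 0 < P) {g : ℝ → ℂ}
    (hg : MemLp g 2 (volume.restrict (Set.Ico 0 (1 / P)))) :
    ∑' m : ℤ, ‖fiberCoeff P g m‖ₑ ^ 2
      = ENNReal.ofReal P * ∫⁻ f in Set.Ico 0 (1 / P), ‖g f‖ₑ ^ 2 := by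
  have hb : (0 : ℝ) < 1 / P := by positivity
  have hg' : MemLp g 2 (volume.restrict (Set.Ioc 0 (1 / P))) := by
    rwa [← restrict_Ico_eq_restrict_Ioc]
  have h := hasSum_sq_fourierCoeffOn hb hg'
  have hco : ∀ m : ℤ, fourierCoeffOn hb g m = fiberCoeff P g m := by
    intro m
    rw [fourierCoeffOn_eq_integral, fiberCoeff, intervalIntegral.integral_of_le hb.le,
      ← restrict_Ico_eq_restrict_Ioc, sub_zero, one_div_one_div, Complex.real_smul]
    congr 1
    refine integral_congr_ae (ae_of_all _ fun f => ?_)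
    simp only [smul_eq_mul]
    rw [mul_comm]
    congr 1
    rw [fourier_coe_apply, tone]
    congr 1
    push_cast
    field_simp
  simp only [hco] at h
  have h1 := ENNReal.ofReal_tsum_of_nonneg (fun m => by positivity) h.summable
  rw [h.tsum_eq, intervalIntegral.integral_of_le hb.le, ← restrict_Ico_eq_restrict_Ioc, sub_zero,
    one_div, inv_inv, smul_eq_mul, ENNReal.ofReal_mul hP.le,
    ofReal_integral_eq_lintegral_ofReal _ (ae_of_all _ fun _ => by positivity)] at h1
  · simp only [ENNReal.ofReal_pow (norm_nonneg _), ofReal_norm] at h1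
    rw [one_div]
    exact h1.symm
  · rw [one_div] at hg
    exact hg.integrable_norm_pow two_ne_zero

theorem integral_tone_mul {P : ℝ} (hP : 0 < P) (k : ℤ) :
    (P : ℂ) * ∫ f in Set.Ico 0 (1 / P), tone (k * P) f = if k = 0 then 1 else 0 := by
  have hb : (0 : ℝ) < 1 / P := by positivity
  have hPC : (P : ℂ) ≠ 0 := by exact_mod_cast hP.ne'
  rw [integral_Ico_eq_integral_Ioc, ← intervalIntegral.integral_of_le hb.le]
  split_ifs with h
  · subst h
    simp [tone, hPC]
  · have hc : (2 * Real.pi * Complex.I * ((k * P : ℝ) : ℂ)) ≠ 0 := by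
      have : (k : ℂ) ≠ 0 := by exact_mod_cast h
      have := Real.pi_ne_zero
      simp [*]
    unfold tone
    rw [integral_exp_mul_complex hc]
    have h1 : (2 * Real.pi * Complex.I * ((k * P : ℝ) : ℂ)) * ((1 / P : ℝ) : ℂ)
        = k * (2 * Real.pi * Complex.I) := by
      push_cast
      field_simp
    rw [h1, Complex.exp_int_mul_two_pi_mul_I]
    simp

theorem continuous_tone (ν : ℝ) : Continuous (tone ν) := by
  unfold tone
  fun_prop

theorem integrableOn_mul_tone {g : ℝ → ℂ} {s : Set ℝ} (hg : IntegrableOn g s) (ν : ℝ) :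
    IntegrableOn (fun f => g f * tone ν f) s := by
  refine Integrable.mul_bdd (c := 1) hg (continuous_tone ν).aestronglyMeasurable ?_
  exact ae_of_all _ fun f => (norm_tone ν f).le

/-- Orthogonality of the tones. With `a` the coefficients of `g`, subtracting a partial sum deletes
the coefficients in `S`, so Parseval evaluates the remainder. -/
theorem fiberCoeff_sub_sum {P : ℝ} (hP : 0 < P) {g : ℝ → ℂ}
    (hg : MemLp g 2 (volume.restrict (Set.Ico 0 (1 / P)))) (S : Finset ℤ) (a : ℤ → ℂ) (m : ℤ) :
    fiberCoeff P (fun f => g f - ∑ k ∈ S, a k * tone (k * P) f) m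
      = fiberCoeff P g m - if m ∈ S then a m else 0 := by
  classical
  have hgi : IntegrableOn g (Set.Ico 0 (1 / P)) := hg.integrable (by norm_num)
  have hti : ∀ ν, IntegrableOn (tone ν) (Set.Ico 0 (1 / P)) := fun ν =>
    ((continuous_tone ν).integrableOn_Icc (a := 0) (b := 1 / P)).mono_set Set.Ico_subset_Icc_self
  unfold fiberCoeff
  have e : ∀ f, (g f - ∑ k ∈ S, a k * tone (k * P) f) * tone (-(m * P)) f
      = g f * tone (-(m * P)) f - ∑ k ∈ S, a k * tone ((k - m : ℤ) * P) f := by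
    intro f
    rw [sub_mul, Finset.sum_mul]
    congr 1
    refine Finset.sum_congr rfl fun k _ => ?_
    rw [mul_assoc, ← tone_add]
    congr 2
    push_cast
    ring
  simp only [e]
  rw [integral_sub (integrableOn_mul_tone hgi _)
    (integrable_finsetSum _ fun k _ => (hti _).const_mul _), mul_sub,
    integral_finsetSum _ fun k _ => (hti _).const_mul _, Finset.mul_sum]
  congr 1
  simp only [integral_const_mul]
  have e2 : ∀ k ∈ S, (P : ℂ) * (a k * ∫ f in Set.Ico 0 (1 / P), tone ((k - m : ℤ) * P) f)
      = if k = m then a k else 0 := by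
    intro k _
    rw [mul_left_comm, integral_tone_mul hP]
    by_cases h : k = m <;> simp [h, sub_eq_zero]
  rw [Finset.sum_congr rfl e2, Finset.sum_ite_eq']

/-- Parseval's identity for the remainders of the expansion of `g`. -/
theorem lintegral_remainder {P : ℝ} (hP : 0 < P) {g : ℝ → ℂ}
    (hg : MemLp g 2 (volume.restrict (Set.Ico 0 (1 / P)))) (S : Finset ℤ) :
    ENNReal.ofReal P *
        ∫⁻ f in Set.Ico 0 (1 / P), ‖g f - ∑ k ∈ S, fiberCoeff P g k * tone (k * P) f‖ₑ ^ 2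
      = ∑' m : {m // m ∉ S}, ‖fiberCoeff P g m‖ₑ ^ 2 := by
  classical
  have hS : MemLp (fun f => ∑ k ∈ S, fiberCoeff P g k * tone (k * P) f) 2
      (volume.restrict (Set.Ico 0 (1 / P))) := by
    refine memLp_finsetSum S fun k _ => MemLp.const_mul ?_ _
    refine MemLp.of_bound (continuous_tone _).aestronglyMeasurable 1 ?_
    exact ae_of_all _ fun f => (norm_tone _ f).le
  refine (tsum_enorm_fiberCoeff hP (hg.sub hS)).symm.trans ?_
  have := tsum_subtype {m | m ∉ S} fun m => ‖fiberCoeff P g m‖ₑ ^ 2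
  refine Eq.trans (tsum_congr fun m => ?_) this.symm
  have h1 := fiberCoeff_sub_sum hP hg S (fiberCoeff P g) m
  change ‖fiberCoeff P (fun f => g f - ∑ k ∈ S, fiberCoeff P g k * tone (k * P) f) m‖ₑ ^ 2 = _
  rw [h1]
  by_cases h : m ∈ S
  · simp [h]
  · simp [h]

/-- The function on the line whose Zak transform on `[0, P) × [0, 1/P)` is `G`. -/
def invZak (P : ℝ) (G : ℝ × ℝ → ℂ) (x : ℝ) : ℂ :=
  fiberCoeff P (fun f => G (x - ⌊x / P⌋ * P, f)) (-⌊x / P⌋)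

theorem invZak_apply {P : ℝ} (hP : 0 < P) (G : ℝ × ℝ → ℂ) {t : ℝ} (ht : t ∈ Set.Ico 0 P)
    (m : ℤ) : invZak P G (t - m * P) = fiberCoeff P (fun f => G (t, f)) m := by
  have h : ⌊(t - m * P) / P⌋ = -m := by
    rw [sub_div, mul_div_cancel_right₀ _ hP.ne', Int.floor_eq_iff]
    have h1 : 0 ≤ t / P := div_nonneg ht.1 hP.le
    have h2 : t / P < 1 := (div_lt_one hP).2 ht.2
    push_cast
    constructor <;> linarith
  unfold invZak
  rw [h]
  push_cast
  rw [neg_neg]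
  congr 2
  funext f
  congr 2
  ring

theorem stronglyMeasurable_invZak (P : ℝ) {G : ℝ × ℝ → ℂ} (hG : Measurable G) :
    StronglyMeasurable (invZak P G) := by
  unfold invZak fiberCoeff
  refine StronglyMeasurable.const_mul (StronglyMeasurable.integral_prod_right
    (f := fun x f => G (x - ⌊x / P⌋ * P, f) * tone (-((-⌊x / P⌋ : ℤ) * P)) f) ?_) _
  refine Measurable.stronglyMeasurable ?_
  have h1 : Measurable fun p : ℝ × ℝ => ((⌊p.1 / P⌋ : ℤ) : ℝ) :=
    (measurable_from_top (f := fun n : ℤ => (n : ℝ))).comp (Int.measurable_floor.comp (by fun_prop))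
  refine (hG.comp (by fun_prop : Measurable fun p : ℝ × ℝ =>
    (p.1 - ⌊p.1 / P⌋ * P, p.2))).mul ?_
  refine continuous_tone_uncurry.measurable.comp (?_ : Measurable fun p : ℝ × ℝ =>
    (-((-⌊p.1 / P⌋ : ℤ) * P), p.2))
  push_cast
  fun_prop

theorem measurable_fiberCoeff (P : ℝ) {G : ℝ × ℝ → ℂ} (hG : Measurable G) (m : ℤ) :
    Measurable fun t => fiberCoeff P (fun f => G (t, f)) m := by
  unfold fiberCoeff
  refine (StronglyMeasurable.const_mul (StronglyMeasurable.integral_prod_right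
    (f := fun t f => G (t, f) * tone (-(m * P)) f) ?_) _).measurable
  refine Measurable.stronglyMeasurable ?_
  exact hG.mul ((continuous_tone _).measurable.comp measurable_snd)

theorem memLp_two_of_lintegral {α : Type*} [MeasurableSpace α] {μ : Measure α} {f : α → ℂ}
    (hf : AEStronglyMeasurable f μ) (h : ∫⁻ x, ‖f x‖ₑ ^ 2 ∂μ < ∞) : MemLp f 2 μ := by
  refine ⟨hf, ?_⟩
  rw [← eLpNorm_two_sq] at h
  by_contra hc
  rw [not_lt, top_le_iff] at hc
  rw [hc] at h
  simp at h

theorem ae_memLp_fiber {P : ℝ} {G : ℝ × ℝ → ℂ} (hG : Measurable G)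
    (hG2 : MemLp G 2 (volume.restrict (Set.Ico 0 P ×ˢ Set.Ico 0 (1 / P)))) :
    ∀ᵐ t ∂(volume.restrict (Set.Ico 0 P)),
      MemLp (fun f => G (t, f)) 2 (volume.restrict (Set.Ico 0 (1 / P))) := by
  have h := hG2.2
  have h1 : eLpNorm G 2 (volume.restrict (Set.Ico 0 P ×ˢ Set.Ico 0 (1 / P))) ^ 2 < ∞ :=
    ENNReal.pow_lt_top h
  rw [eLpNorm_two_sq, Measure.volume_eq_prod, setLIntegral_prod _ (by fun_prop)] at h1
  have hm : Measurable fun u : ℝ × ℝ => ‖G u‖ₑ ^ 2 := by fun_prop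
  filter_upwards [ae_lt_top hm.lintegral_prod_right' h1.ne] with t ht
  exact memLp_two_of_lintegral
    (hG.comp (by fun_prop : Measurable fun f : ℝ => (t, f))).aestronglyMeasurable ht

/-- The Plancherel identity for the Zak transform. -/
theorem lintegral_invZak {P : ℝ} (hP : 0 < P) {G : ℝ × ℝ → ℂ} (hG : Measurable G)
    (hG2 : MemLp G 2 (volume.restrict (Set.Ico 0 P ×ˢ Set.Ico 0 (1 / P)))) :
    ∑' m : ℤ, ∫⁻ t in Set.Ico 0 P, ‖fiberCoeff P (fun f => G (t, f)) m‖ₑ ^ 2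
        = ENNReal.ofReal P * ∫⁻ u in Set.Ico 0 P ×ˢ Set.Ico 0 (1 / P), ‖G u‖ₑ ^ 2 ∧
      ∫⁻ x, ‖invZak P G x‖ₑ ^ 2
        = ENNReal.ofReal P * ∫⁻ u in Set.Ico 0 P ×ˢ Set.Ico 0 (1 / P), ‖G u‖ₑ ^ 2 := by
  have h1 : ∑' m : ℤ, ∫⁻ t in Set.Ico 0 P, ‖fiberCoeff P (fun f => G (t, f)) m‖ₑ ^ 2
      = ENNReal.ofReal P * ∫⁻ u in Set.Ico 0 P ×ˢ Set.Ico 0 (1 / P), ‖G u‖ₑ ^ 2 := by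
    have hm : Measurable fun u : ℝ × ℝ => ‖G u‖ₑ ^ 2 := by fun_prop
    rw [← lintegral_tsum fun m => ((measurable_fiberCoeff P hG m).enorm.pow_const 2).aemeasurable,
      Measure.volume_eq_prod, setLIntegral_prod _ (by fun_prop),
      ← lintegral_const_mul _ hm.lintegral_prod_right']
    refine lintegral_congr_ae ?_
    filter_upwards [ae_memLp_fiber hG hG2] with t ht
    exact tsum_enorm_fiberCoeff hP ht
  refine ⟨h1, ?_⟩
  -- The Zak series runs over `t - m * P`, the decomposition of the line over `t + n * P`.
  rw [← h1, lintegral_eq_tsum_translates hP, ← (Equiv.neg ℤ).tsum_eq]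
  refine tsum_congr fun m => setLIntegral_congr_fun measurableSet_Ico fun t ht => ?_
  simp only [Equiv.neg_apply]
  rw [← invZak_apply hP G ht m]
  congr 3
  push_cast
  ring

theorem tendsto_zero_of_sq {u : ℕ → ℝ≥0∞} (h : Tendsto (fun n => u n ^ 2) atTop (𝓝 0)) :
    Tendsto u atTop (𝓝 0) := by
  have h1 := (ENNReal.continuous_rpow_const (y := (1 / 2 : ℝ))).tendsto 0 |>.comp h
  rw [ENNReal.zero_rpow_of_pos (by norm_num)] at h1
  refine h1.congr fun n => ?_
  simp only [Function.comp_apply]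
  rw [← ENNReal.rpow_natCast, ← ENNReal.rpow_mul]
  norm_num

/-- Every function in `L²([0, P) × [0, 1/P))` is a Zak transform. -/
theorem exists_isZakTransform {P : ℝ} (hP : 0 < P) {G : ℝ × ℝ → ℂ} (hG : Measurable G)
    (hG2 : MemLp G 2 (volume.restrict (Set.Ico 0 P ×ˢ Set.Ico 0 (1 / P)))) :
    ∃ y : Lp ℂ 2 (volume : Measure ℝ), y =ᵐ[volume] invZak P G ∧ IsZakTransform P y G ∧
      ‖y‖ₑ ^ 2 = ENNReal.ofReal P * ∫⁻ u in Set.Ico 0 P ×ˢ Set.Ico 0 (1 / P), ‖G u‖ₑ ^ 2 := by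
  have hfin : ENNReal.ofReal P * ∫⁻ u in Set.Ico 0 P ×ˢ Set.Ico 0 (1 / P), ‖G u‖ₑ ^ 2 < ∞ := by
    rw [← eLpNorm_two_sq]
    exact ENNReal.mul_lt_top ENNReal.ofReal_lt_top (ENNReal.pow_lt_top hG2.2)
  have hPl := lintegral_invZak hP hG hG2
  have hy : MemLp (invZak P G) 2 (volume : Measure ℝ) :=
    memLp_two_of_lintegral (stronglyMeasurable_invZak P hG).aestronglyMeasurable
      (hPl.2 ▸ hfin)
  refine ⟨hy.toLp, hy.coeFn_toLp, ⟨hG2, ?_⟩, ?_⟩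
  swap
  · rw [Lp.enorm_toLp, eLpNorm_two_sq, hPl.2]
  apply tendsto_zero_of_sq
  have hP0 : ENNReal.ofReal P ≠ 0 := by simpa using hP
  have hrem : ∀ N : ℕ, eLpNorm (fun u : ℝ × ℝ => G u -
        ∑ m ∈ Finset.Icc (-(N : ℤ)) N, (hy.toLp : Lp ℂ 2 (volume : Measure ℝ))
          (u.1 - (m : ℝ) * P) * tone ((m : ℝ) * P) u.2)
      2 (volume.restrict (Set.Ico 0 P ×ˢ Set.Ico 0 (1 / P))) ^ 2
      = (ENNReal.ofReal P)⁻¹ * ∑' m : {m // m ∉ Finset.Icc (-(N : ℤ)) N},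
        ∫⁻ t in Set.Ico 0 P, ‖fiberCoeff P (fun f => G (t, f)) m‖ₑ ^ 2 := by
    intro N
    rw [eLpNorm_two_sq]
    have hae : ∀ᵐ u ∂(volume.restrict (Set.Ico 0 P ×ˢ Set.Ico 0 (1 / P)) : Measure (ℝ × ℝ)),
        ∀ m : ℤ, (hy.toLp : Lp ℂ 2 (volume : Measure ℝ)) (u.1 - (m : ℝ) * P)
          = fiberCoeff P (fun f => G (u.1, f)) m := by
      rw [ae_all_iff]
      intro m
      have hq : Measure.QuasiMeasurePreserving (fun u : ℝ × ℝ => u.1 - (m : ℝ) * P)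
          volume volume :=
        (measurePreserving_sub_right (volume : Measure ℝ)
          ((m : ℝ) * P)).quasiMeasurePreserving.comp Measure.quasiMeasurePreserving_fst
      filter_upwards [ae_restrict_of_ae (hq.ae hy.coeFn_toLp),
        ae_restrict_mem (measurableSet_Ico.prod measurableSet_Ico)] with u h1 h2
      rw [h1, invZak_apply hP G h2.1]
    rw [lintegral_congr_ae (g := fun u : ℝ × ℝ => ‖G u - ∑ m ∈ Finset.Icc (-(N : ℤ)) N,
      fiberCoeff P (fun f => G (u.1, f)) m * tone ((m : ℝ) * P) u.2‖ₑ ^ 2) (by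
        filter_upwards [hae] with u hu
        simp only [hu])]
    have hmeas : Measurable fun u : ℝ × ℝ => ‖G u - ∑ m ∈ Finset.Icc (-(N : ℤ)) N,
        fiberCoeff P (fun f => G (u.1, f)) m * tone ((m : ℝ) * P) u.2‖ₑ ^ 2 := by
      refine Measurable.pow_const (Measurable.enorm (hG.sub ?_)) 2
      refine Finset.measurable_fun_sum _ fun m _ => ?_
      exact ((measurable_fiberCoeff P hG m).comp measurable_fst).mul
        ((continuous_tone _).measurable.comp measurable_snd)
    rw [Measure.volume_eq_prod, setLIntegral_prod _ hmeas.aemeasurable,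
      ← lintegral_tsum fun m : {m // m ∉ Finset.Icc (-(N : ℤ)) N} =>
        ((measurable_fiberCoeff P hG m.1).enorm.pow_const 2).aemeasurable,
      ← lintegral_const_mul' _ _ (ENNReal.inv_ne_top.2 hP0)]
    refine lintegral_congr_ae ?_
    filter_upwards [ae_memLp_fiber hG hG2] with t ht
    rw [← lintegral_remainder hP ht, ← mul_assoc, ENNReal.inv_mul_cancel hP0 ENNReal.ofReal_ne_top,
      one_mul]
  simp only [hrem]
  -- The squared error is a tail of the convergent Plancherel sum.
  have h0 := (ENNReal.tendsto_tsum_compl_atTop_zero (hPl.1 ▸ hfin.ne)).comp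
    (Finset.tendsto_Icc_neg_atTop_atTop (α := ℤ) |>.comp tendsto_natCast_atTop_atTop)
  have h1 := ENNReal.Tendsto.const_mul h0 (Or.inr (ENNReal.inv_ne_top.2 hP0))
  rw [mul_zero] at h1
  exact h1

/-- Both functions are `L²` limits of the same partial sums. Statements about every Zak transform of
the response thereby reduce to the explicit one, `responseZak`. -/
theorem IsZakTransform.ae_eq {P : ℝ} {y : Lp ℂ 2 (volume : Measure ℝ)} {ζ ξ : ℝ × ℝ → ℂ}
    (hζ : IsZakTransform P y ζ) (hξ : IsZakTransform P y ξ) :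
    ζ =ᵐ[volume.restrict (Set.Ico 0 P ×ˢ Set.Ico 0 (1 / P))] ξ := by
  have hmeas : ∀ N : ℕ, AEStronglyMeasurable (fun u : ℝ × ℝ =>
      ∑ m ∈ Finset.Icc (-(N : ℤ)) N, y (u.1 - (m : ℝ) * P) * tone ((m : ℝ) * P) u.2)
      (volume.restrict (Set.Ico 0 P ×ˢ Set.Ico 0 (1 / P))) := by
    intro N
    refine AEStronglyMeasurable.restrict ?_
    refine Finset.aestronglyMeasurable_fun_sum _ fun m _ => ?_
    have hq : Measure.QuasiMeasurePreserving (fun u : ℝ × ℝ => u.1 - (m : ℝ) * P)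
        volume volume :=
      (measurePreserving_sub_right (volume : Measure ℝ)
        ((m : ℝ) * P)).quasiMeasurePreserving.comp Measure.quasiMeasurePreserving_fst
    exact ((Lp.aestronglyMeasurable y).comp_quasiMeasurePreserving hq).mul
      ((continuous_tone _).comp continuous_snd).aestronglyMeasurable
  have h0 : eLpNorm (ζ - ξ) 2 (volume.restrict (Set.Ico 0 P ×ˢ Set.Ico 0 (1 / P))) = 0 := by
    have hadd := hζ.2.add hξ.2
    rw [add_zero] at hadd
    have hle := ge_of_tendsto' hadd fun N => by
      have := eLpNorm_sub_le (p := 2) (hζ.1.aestronglyMeasurable.sub (hmeas N))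
        (hξ.1.aestronglyMeasurable.sub (hmeas N)) (by norm_num)
      rwa [sub_sub_sub_cancel_right] at this
    exact le_antisymm hle bot_le
  rw [eLpNorm_eq_zero_iff (hζ.1.aestronglyMeasurable.sub hξ.1.aestronglyMeasurable)
    (by norm_num)] at h0
  filter_upwards [h0] with u hu
  exact sub_eq_zero.1 hu

/-! ### The response to a Dirac train -/

theorem integrable_lp_mul_schwartz (y : Lp ℂ 2 (volume : Measure ℝ)) (φ : 𝓢(ℝ, ℂ)) :
    Integrable fun t => y t * φ t :=
  (Lp.memLp y).integrable_mul (φ.memLp 2)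

theorem IsResponse.sub {H₁ H₂ : Op} {x : 𝓢'(ℝ, ℂ)} {y₁ y₂ : Lp ℂ 2 (volume : Measure ℝ)}
    (h₁ : IsResponse H₁ x y₁) (h₂ : IsResponse H₂ x y₂) :
    IsResponse (H₁ - H₂) x (y₁ - y₂) := by
  intro φ
  have hae : (fun p : ℝ × ℝ => (H₁ - H₂ : Op) p * modulation p.2 (translation p.1 x) φ)
      =ᵐ[volume] (fun p => H₁ p * modulation p.2 (translation p.1 x) φ
        - H₂ p * modulation p.2 (translation p.1 x) φ) := by
    filter_upwards [Lp.coeFn_sub H₁ H₂] with p hp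
    rw [hp, Pi.sub_apply, sub_mul]
  refine ⟨((h₁ φ).1.sub (h₂ φ).1).congr hae.symm, ?_⟩
  rw [integral_congr_ae hae, integral_sub (h₁ φ).1 (h₂ φ).1, ← (h₁ φ).2, ← (h₂ φ).2,
    ← integral_sub (integrable_lp_mul_schwartz y₁ φ) (integrable_lp_mul_schwartz y₂ φ)]
  refine integral_congr_ae ?_
  filter_upwards [Lp.coeFn_sub y₁ y₂] with t ht
  rw [ht, Pi.sub_apply, sub_mul]

/-- The difference is a response of the zero operator, hence orthogonal to all smooth compactly
supported functions. It identifies a given response with the one constructed in `exists_response`.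
-/
theorem IsResponse.unique {H : Op} {x : 𝓢'(ℝ, ℂ)} {y₁ y₂ : Lp ℂ 2 (volume : Measure ℝ)}
    (h₁ : IsResponse H x y₁) (h₂ : IsResponse H x y₂) : y₁ = y₂ := by
  rw [← sub_eq_zero, Lp.eq_zero_iff_ae_eq_zero]
  have h0 := h₁.sub h₂
  refine ae_eq_zero_of_integral_contDiff_smul_eq_zero
    ((Lp.memLp (y₁ - y₂)).locallyIntegrable (by norm_num)) fun g hg hgs => ?_
  have hs : HasCompactSupport fun t => (g t : ℂ) := hgs.comp_left (g := fun r : ℝ => (r : ℂ)) rfl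
  have hd : ContDiff ℝ (⊤ : ℕ∞) fun t => (g t : ℂ) := Complex.ofRealCLM.contDiff.comp hg
  have h1 := (h0 (hs.toSchwartzMap hd)).2
  rw [sub_self] at h1
  have h2 : ∫ p : ℝ × ℝ, (0 : Op) p * modulation p.2 (translation p.1 x) (hs.toSchwartzMap hd)
      = 0 := by
    rw [integral_congr_ae (g := fun _ => (0 : ℂ)) (by
      filter_upwards [Lp.coeFn_zero ℂ 2 (volume : Measure (ℝ × ℝ))] with p hp
      rw [hp, Pi.zero_apply, zero_mul])]
    simp
  rw [h2] at h1
  rw [← h1]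
  refine integral_congr_ae (ae_of_all _ fun t => ?_)
  simp [mul_comm]

/-- The pairing of a time-frequency shift of the Dirac train with a test function. -/
theorem hasSum_pairing (hT : 0 < T) [NeZero L] (c : ZMod L → ℂ) (φ : 𝓢(ℝ, ℂ)) (p : ℝ × ℝ) :
    HasSum (fun k : ℤ => c (k : ZMod L) * (tone p.2 (p.1 - k * T) * φ (p.1 - k * T)))
      (modulation p.2 (translation p.1 (diracTrain T c)) φ) := by
  rw [modulation_translation_apply]
  refine (diracTrain_apply hT c _).congr_fun fun k => ?_
  rw [SchwartzMap.compSubConstCLM_apply,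
    SchwartzMap.smulLeftCLM_apply_apply (tone_hasTemperateGrowth _), smul_eq_mul]
  congr 3 <;> ring

theorem measurable_pairing (hT : 0 < T) [NeZero L] (c : ZMod L → ℂ) (φ : 𝓢(ℝ, ℂ)) :
    StronglyMeasurable fun p : ℝ × ℝ => modulation p.2 (translation p.1 (diracTrain T c)) φ := by
  refine stronglyMeasurable_of_tendsto (atTop : Filter (Finset ℤ))
    (f := fun (s : Finset ℤ) (p : ℝ × ℝ) =>
      ∑ k ∈ s, c (k : ZMod L) * (tone p.2 (p.1 - k * T) * φ (p.1 - k * T)))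
    (fun s => Continuous.stronglyMeasurable ?_)
    (tendsto_pi_nhds.2 fun p => hasSum_pairing hT c φ p)
  refine continuous_finsetSum _ fun k _ => continuous_const.mul (Continuous.mul ?_ ?_)
  · exact continuous_tone_uncurry.comp
      (by fun_prop : Continuous fun p : ℝ × ℝ => (p.2, p.1 - (k : ℝ) * T))
  · exact φ.continuous.comp (by fun_prop)

/-- Schwartz functions are summable along the translates of `[0, T)`, uniformly. -/
theorem exists_summable_bound (hT : 0 < T) (φ : 𝓢(ℝ, ℂ)) :
    ∃ b : ℤ → ℝ, Summable b ∧ ∀ n : ℤ, ∀ t ∈ Set.Ico 0 T, ‖φ (t + n * T)‖ ≤ b n := by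
  let C : ℝ := 2 ^ 2 * (Finset.Iic ((2, 0) : ℕ × ℕ)).sup (schwartzSeminormFamily ℂ ℝ ℂ) φ
  have hC : ∀ x : ℝ, (1 + |x|) ^ 2 * ‖φ x‖ ≤ C := by
    intro x
    have h := SchwartzMap.one_add_le_sup_seminorm_apply (𝕜 := ℂ) (m := (2, 0)) (k := 2) (n := 0)
      le_rfl le_rfl φ x
    simp only [norm_iteratedFDeriv_zero, Real.norm_eq_abs] at h
    exact h
  refine ⟨fun n => ((1 + |(n : ℝ) * T|) ^ 2)⁻¹ * ((1 + T) ^ 2 * C),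
    (summable_train hT).mul_right _, fun n t ht => ?_⟩
  simp only
  rw [← div_eq_inv_mul, le_div_iff₀' (by positivity)]
  have h1 : 1 + |(n : ℝ) * T| ≤ (1 + T) * (1 + |t + n * T|) := by
    have h2 : |(n : ℝ) * T| ≤ |t + n * T| + T := by
      have h3 := abs_sub (t + n * T) t
      rw [add_sub_cancel_left, abs_of_nonneg ht.1] at h3
      linarith [ht.2]
    nlinarith [abs_nonneg (t + n * T), hT]
  calc (1 + |(n : ℝ) * T|) ^ 2 * ‖φ (t + n * T)‖
      ≤ ((1 + T) * (1 + |t + n * T|)) ^ 2 * ‖φ (t + n * T)‖ := by gcongr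
    _ = (1 + T) ^ 2 * ((1 + |t + n * T|) ^ 2 * ‖φ (t + n * T)‖) := by ring
    _ ≤ (1 + T) ^ 2 * C := by gcongr; exact hC _

/-- The contribution of the impulse that arrives in the `n`-th period and of the cell `i` to the
response, paired with a test function. -/
def contribution (T : ℝ) {L : ℕ} (c : ZMod L → ℂ) (H : Op) (φ : 𝓢(ℝ, ℂ)) (n : ℤ)
    (i : Fin L × Fin L) (u : ℝ × ℝ) : ℂ :=
  c (((i.1 : ℕ) : ZMod L) - (n : ZMod L)) * cellComponent T L H i u *
    tone (u.2 + (corner T L i).2) (n * T) * φ (u.1 + n * T)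

/-- The impulse at `-kT`, delayed by `u.1` plus `i.1` periods, arrives at `u.1 + nT` with `n = i.1 -
k`; the series is reindexed by `n`. Its phase splits at `u.1`, and that part is absorbed into the
cell component. -/
theorem hasSum_contribution (hT : 0 < T) [NeZero L] (c : ZMod L → ℂ) (H : Op) (φ : 𝓢(ℝ, ℂ))
    (i : Fin L × Fin L) (u : ℝ × ℝ) :
    HasSum (fun n => contribution T c H φ n i u)
      (H (u + corner T L i) * modulation (u + corner T L i).2
        (translation (u + corner T L i).1 (diracTrain T c)) φ) := by
  have h := (hasSum_pairing hT c φ (u + corner T L i)).mul_left (H (u + corner T L i))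
  rw [← (Equiv.subLeft ((i.1 : ℕ) : ℤ)).hasSum_iff] at h
  refine h.congr_fun fun n => ?_
  simp only [Function.comp_apply, Equiv.subLeft_apply, contribution, cellComponent_eq]
  have e : (u + corner T L i).1 - ((((i.1 : ℕ) : ℤ) - n : ℤ) : ℝ) * T = u.1 + n * T := by
    simp only [corner, Prod.fst_add]
    push_cast
    ring
  rw [e, Prod.snd_add, tone_apply_add]
  push_cast
  ring

theorem norm_contribution_le [NeZero L] (c : ZMod L → ℂ) (H : Op) {φ : 𝓢(ℝ, ℂ)} {b : ℤ → ℝ}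
    (hb : ∀ n : ℤ, ∀ t ∈ Set.Ico 0 T, ‖φ (t + n * T)‖ ≤ b n) (n : ℤ) (i : Fin L × Fin L)
    {u : ℝ × ℝ} (hu : u ∈ cell T L) :
    ‖contribution T c H φ n i u‖ ≤ b n * ((∑ j, ‖c j‖) * ‖cellComponent T L H i u‖) := by
  unfold contribution
  rw [norm_mul, norm_mul, norm_mul, norm_tone, mul_one, mul_comm]
  have h1 : ‖c (((i.1 : ℕ) : ZMod L) - (n : ZMod L))‖ ≤ ∑ j, ‖c j‖ :=
    Finset.single_le_sum (f := fun j => ‖c j‖) (fun _ _ => norm_nonneg _) (Finset.mem_univ _)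
  have h2 := hb n u.1 hu.1
  have h3 := (norm_nonneg _).trans h2
  gcongr

theorem integrableOn_cellComponent (H : Op) (i : Fin L × Fin L) :
    IntegrableOn (cellComponent T L H i) (cell T L) := by
  have : IsFiniteMeasure (volume.restrict (cell T L)) :=
    ⟨by rw [Measure.restrict_apply_univ]; exact volume_cell_lt_top⟩
  exact (memLp_cellComponent H i).integrable (by norm_num)

theorem stronglyMeasurable_cellComponent (H : Op) (i : Fin L × Fin L) :
    StronglyMeasurable (cellComponent T L H i) := by
  refine ((Lp.stronglyMeasurable H).comp_measurable
    (measurePreserving_add_corner i).measurable).mul ?_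
  refine Continuous.stronglyMeasurable ?_
  exact continuous_tone_uncurry.comp (by fun_prop : Continuous fun u : ℝ × ℝ =>
    (u.2 + (i.2 : ℝ) / (T * L), u.1))

theorem integrableOn_contribution (hT : 0 < T) [NeZero L] (c : ZMod L → ℂ) (H : Op)
    (φ : 𝓢(ℝ, ℂ)) (n : ℤ) (i : Fin L × Fin L) :
    IntegrableOn (contribution T c H φ n i) (cell T L) := by
  obtain ⟨b, -, hb⟩ := exists_summable_bound hT φ
  refine Integrable.mono'
    (((integrableOn_cellComponent H i).norm.const_mul (∑ j, ‖c j‖)).const_mul (b n)) ?_ ?_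
  · refine StronglyMeasurable.aestronglyMeasurable ?_
    refine (((stronglyMeasurable_cellComponent H i).const_mul _).mul
      (Continuous.stronglyMeasurable ?_)).mul (Continuous.stronglyMeasurable ?_)
    · exact continuous_tone_uncurry.comp (by fun_prop : Continuous fun u : ℝ × ℝ =>
        (u.2 + (corner T L i).2, (n : ℝ) * T))
    · exact φ.continuous.comp (by fun_prop)
  · filter_upwards [ae_restrict_mem measurableSet_cell] with u hu
    exact norm_contribution_le c H hb n i hu

/-- The decay of the test function gives a summable bound times an integrable function on the cell,
which justifies exchanging sum and integral. -/
theorem hasSum_integral_contribution (hT : 0 < T) [NeZero L] (c : ZMod L → ℂ) (H : Op)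
    (φ : 𝓢(ℝ, ℂ)) (i : Fin L × Fin L) :
    IntegrableOn (fun p : ℝ × ℝ => H p * modulation p.2 (translation p.1 (diracTrain T c)) φ)
        (corner T L i +ᵥ cell T L) ∧
      HasSum (fun n => ∫ u in cell T L, contribution T c H φ n i u)
        (∫ p in corner T L i +ᵥ cell T L,
          H p * modulation p.2 (translation p.1 (diracTrain T c)) φ) := by
  obtain ⟨b, hbs, hb⟩ := exists_summable_bound hT φ
  have hpre : cell T L
      = (fun u : ℝ × ℝ => u + corner T L i) ⁻¹' (corner T L i +ᵥ cell T L) := by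
    ext u
    rw [Set.mem_preimage, mem_cell_vadd, add_sub_cancel_right]
  have hemb := (MeasurableEquiv.addRight (corner T L i)).measurableEmbedding
  constructor
  · rw [← (measurePreserving_add_corner (T := T) i).integrableOn_comp_preimage hemb, ← hpre]
    refine Integrable.mono'
      (((integrableOn_cellComponent (T := T) H i).norm.const_mul (∑ j, ‖c j‖)).const_mul
        (∑' n, b n)) ?_ ?_
    · refine StronglyMeasurable.aestronglyMeasurable ?_
      exact ((Lp.stronglyMeasurable H).mul (measurable_pairing hT c φ)).comp_measurable
        (measurePreserving_add_corner i).measurable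
    · filter_upwards [ae_restrict_mem measurableSet_cell] with u hu
      rw [← tsum_mul_right]
      rw [Function.comp_apply, ← (hasSum_contribution hT c H φ i u).tsum_eq]
      exact tsum_of_norm_bounded (hbs.mul_right _).hasSum
        fun n => norm_contribution_le c H hb n i hu
  · have h := (measurePreserving_add_corner (T := T) i).setIntegral_preimage_emb hemb
      (fun p : ℝ × ℝ => H p * modulation p.2 (translation p.1 (diracTrain T c)) φ)
      (corner T L i +ᵥ cell T L)
    rw [← hpre] at h
    rw [← h]
    have h1 := hasSum_integral_of_summable_integral_norm
      (F := fun n => contribution T c H φ n i) (μ := volume.restrict (cell T L))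
      (fun n => integrableOn_contribution hT c H φ n i) (by
        refine Summable.of_nonneg_of_le (fun n => integral_nonneg fun _ => norm_nonneg _)
          (fun n => ?_)
          (hbs.mul_right (∫ u in cell T L, (∑ j, ‖c j‖) * ‖cellComponent T L H i u‖))
        rw [← integral_const_mul]
        refine setIntegral_mono_on (integrableOn_contribution hT c H φ n i).norm
          (((integrableOn_cellComponent H i).norm.const_mul _).const_mul (b n))
          measurableSet_cell fun u hu => norm_contribution_le c H hb n i hu)
    simpa only [(hasSum_contribution hT c H φ i _).tsum_eq] using h1

/-! ### The Zak transform of the response -/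

/-- The entries of the vector `A_c s`, where `s` is the vector of the components of `H`. -/
def rowFun (T : ℝ) {L : ℕ} (c : ZMod L → ℂ) (H : Op) (p : Fin L) (u : ℝ × ℝ) : ℂ :=
  ∑ i, trainMatrix T c p i * cellComponent T L H i u

/-- The Zak transform of the response, see `exists_response`. -/
def responseZak (T : ℝ) {L : ℕ} (c : ZMod L → ℂ) (H : Op) (u : ℝ × ℝ) : ℂ :=
  ∑ p : Fin L, (Set.Ico ((p : ℝ) * T) (((p : ℝ) + 1) * T)).indicator 1 u.1 *
    (rowFun T c H p (u.1 - p * T, u.2) * tone (p * T) u.2)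

theorem responseZak_apply (c : ZMod L → ℂ) (H : Op) (p : Fin L) {t : ℝ} (ht : t ∈ Set.Ico 0 T)
    (f : ℝ) : responseZak T c H (t + p * T, f) = rowFun T c H p (t, f) * tone (p * T) f := by
  have hp : t + p * T ∈ Set.Ico ((p : ℝ) * T) (((p : ℝ) + 1) * T) :=
    ⟨by linarith [ht.1], by linarith [ht.2]⟩
  rw [responseZak, Finset.sum_eq_single p]
  · simp [Set.indicator_of_mem hp]
  · intro q _ hq
    rw [Set.indicator_of_notMem, zero_mul]
    exact fun h => hq (Fin.ext (eq_of_mem_Ico_mul h hp))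
  · simp

theorem stronglyMeasurable_rowFun (c : ZMod L → ℂ) (H : Op) (p : Fin L) :
    StronglyMeasurable (rowFun T c H p) :=
  Finset.stronglyMeasurable_fun_sum _ fun i _ =>
    (stronglyMeasurable_cellComponent H i).const_mul _

theorem measurable_responseZak (c : ZMod L → ℂ) (H : Op) : Measurable (responseZak T c H) := by
  refine Finset.measurable_fun_sum _ fun p _ => Measurable.mul ?_ (Measurable.mul ?_ ?_)
  · exact (measurable_one.indicator measurableSet_Ico).comp measurable_fst
  · exact (stronglyMeasurable_rowFun c H p).measurable.comp (by fun_prop)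
  · exact (continuous_tone _).measurable.comp measurable_snd

theorem coeFn_sum_cellMap (c : ZMod L → ℂ) (H : Op) (p : Fin L) :
    (∑ i, trainMatrix T c p i • cellMap T L i H : Lp ℂ 2 (volume.restrict (cell T L)))
      =ᵐ[volume.restrict (cell T L)] rowFun T c H p := by
  have h2 : ∀ᵐ u ∂(volume.restrict (cell T L)), ∀ i,
      (trainMatrix T c p i • cellMap T L i H : Lp ℂ 2 (volume.restrict (cell T L))) u
        = trainMatrix T c p i * cellComponent T L H i u := by
    refine eventually_all.2 fun i => ?_
    filter_upwards [Lp.coeFn_smul (trainMatrix T c p i) (cellMap T L i H), coeFn_cellMap H i]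
      with u hu hu'
    rw [hu, Pi.smul_apply, hu', smul_eq_mul]
  filter_upwards [h2, Lp.coeFn_finsetSum Finset.univ fun i => trainMatrix T c p i • cellMap T L i H]
    with u hu hu'
  rw [hu', Finset.sum_apply]
  exact Finset.sum_congr rfl fun i _ => hu i

theorem measurePreserving_add_row (p : Fin L) :
    MeasurePreserving (fun u : ℝ × ℝ => u + ((p : ℝ) * T, 0)) volume volume :=
  measurePreserving_add_right volume _

theorem lintegral_rows (hT : 0 < T) (F : ℝ × ℝ → ℝ≥0∞) :
    ∫⁻ u in Set.Ico 0 (T * L) ×ˢ Set.Ico 0 (1 / (T * L)), F u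
      = ∑ p : Fin L, ∫⁻ u in cell T L, F (u.1 + p * T, u.2) := by
  have hU : Set.Ico 0 (T * L) ×ˢ Set.Ico 0 (1 / (T * L))
      = ⋃ p ∈ (Finset.univ : Finset (Fin L)),
        Set.Ico ((p : ℝ) * T) (((p : ℝ) + 1) * T) ×ˢ Set.Ico 0 (1 / (T * L)) := by
    ext ⟨x, f⟩
    simp only [Set.mem_prod, Finset.mem_univ, Set.iUnion_true, Set.mem_iUnion]
    constructor
    · rintro ⟨⟨h1, h2⟩, hf⟩
      have h3 : ⌊x / T⌋₊ < L := by
        rw [Nat.floor_lt (by positivity), div_lt_iff₀ hT]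
        linarith
      refine ⟨⟨⌊x / T⌋₊, h3⟩, ⟨?_, ?_⟩, hf⟩
      · have := Nat.floor_le (a := x / T) (by positivity)
        rwa [le_div_iff₀ hT] at this
      · have := Nat.lt_floor_add_one (x / T)
        rwa [div_lt_iff₀ hT] at this
    · rintro ⟨p, ⟨h1, h2⟩, hf⟩
      have hp : (p : ℝ) + 1 ≤ L := by exact_mod_cast p.2
      refine ⟨⟨le_trans (by positivity) h1, h2.trans_le ?_⟩, hf⟩
      nlinarith
  rw [hU, lintegral_biUnion_finset _ (fun _ _ => measurableSet_Ico.prod measurableSet_Ico)]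
  · refine Finset.sum_congr rfl fun p _ => ?_
    have h := (measurePreserving_add_row (T := T) p).setLIntegral_comp_preimage_emb
      (MeasurableEquiv.addRight ((p : ℝ) * T, (0 : ℝ))).measurableEmbedding F
      (Set.Ico ((p : ℝ) * T) (((p : ℝ) + 1) * T) ×ˢ Set.Ico 0 (1 / (T * L)))
    rw [← h]
    have hpre : (fun u : ℝ × ℝ => u + ((p : ℝ) * T, 0)) ⁻¹'
        (Set.Ico ((p : ℝ) * T) (((p : ℝ) + 1) * T) ×ˢ Set.Ico 0 (1 / (T * L))) = cell T L := by
      ext ⟨t, f⟩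
      simp only [Set.mem_preimage, Prod.mk_add_mk, Set.mem_prod, Set.mem_Ico, cell, add_zero]
      constructor <;> rintro ⟨⟨h1, h2⟩, h3⟩ <;> exact ⟨⟨by linarith, by linarith⟩, h3⟩
    rw [hpre]
    refine lintegral_congr fun u => ?_
    congr 1
    ext <;> simp
  · intro p _ q _ hpq
    rw [Function.onFun, Set.disjoint_left]
    intro u hu hw
    exact hpq (Fin.ext (eq_of_mem_Ico_mul hu.1 hw.1))

theorem lintegral_responseZak (hT : 0 < T) (c : ZMod L → ℂ) (H : Op) :
    ∫⁻ u in Set.Ico 0 (T * L) ×ˢ Set.Ico 0 (1 / (T * L)), ‖responseZak T c H u‖ₑ ^ 2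
      = ∑ p, ‖∑ i, trainMatrix T c p i • cellMap T L i H‖ₑ ^ 2 := by
  rw [lintegral_rows hT]
  refine Finset.sum_congr rfl fun p _ => ?_
  rw [enorm_lp_sq]
  refine lintegral_congr_ae ?_
  filter_upwards [coeFn_sum_cellMap c H p, ae_restrict_mem measurableSet_cell] with u h1 h2
  rw [h1, responseZak_apply c H p h2.1, enorm_mul, enorm_tone, mul_one]

/-- A tone of frequency `m / (TL)` has period `TL`, so at multiples of `T` only the residue modulo
`L` counts. This produces the entries of a constant matrix. -/
theorem tone_natCast_div (hT : 0 < T) [NeZero L] (m : ℕ) (n : ℤ) (p : ℕ) (r : ℤ)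
    (hn : n = p + L * r) :
    Complex.exp (2 * Real.pi * Complex.I * p * m / L) = tone ((m : ℝ) / (T * L)) (n * T) := by
  have hL : (L : ℂ) ≠ 0 := by exact_mod_cast NeZero.ne L
  have hTC : (T : ℂ) ≠ 0 := by exact_mod_cast hT.ne'
  unfold tone
  rw [Complex.exp_eq_exp_iff_exists_int]
  refine ⟨-(m * r), ?_⟩
  rw [hn]
  push_cast
  field_simp
  ring

/-- With `n = p + L * r`, the residue `p` selects the row of `A_c` and the quotient `r` the Fourier
coefficient in frequency. -/
theorem invZak_responseZak (hT : 0 < T) [NeZero L] (c : ZMod L → ℂ) (H : Op) (φ : 𝓢(ℝ, ℂ))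
    (n : ℤ) {t : ℝ} (ht : t ∈ Set.Ico 0 T) :
    invZak (T * L) (responseZak T c H) (t + n * T) * φ (t + n * T)
      = ∫ f in Set.Ico 0 (1 / (T * L)), ∑ i, contribution T c H φ n i (t, f) := by
  have hL : (0 : ℝ) < L := by exact_mod_cast NeZero.pos L
  have hLZ : (0 : ℤ) < L := by exact_mod_cast NeZero.pos L
  have hTL : ((T * L : ℝ) : ℂ) ≠ 0 := by exact_mod_cast (mul_pos hT hL).ne'
  obtain ⟨p, hp⟩ : ∃ p : Fin L, ((p : ℕ) : ℤ) = n % L :=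
    ⟨⟨(n % L).toNat, by
      have := Int.emod_lt_of_pos n hLZ
      have := Int.emod_nonneg n hLZ.ne'
      omega⟩, by simpa using Int.emod_nonneg n hLZ.ne'⟩
  have hn : n = ((p : ℕ) : ℤ) + L * (n / L) := by rw [hp, Int.emod_add_mul_ediv]
  generalize n / (L : ℤ) = r at hn
  have hnR : (n : ℝ) = p + L * r := by rw [hn]; push_cast; rfl
  have hmem : t + p * T ∈ Set.Ico 0 (T * L) := by
    have hpL : ((p : ℕ) : ℝ) + 1 ≤ L := by exact_mod_cast p.2
    exact ⟨by have := ht.1; positivity, by nlinarith [ht.2]⟩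
  have harg : t + n * T = (t + p * T) - ((-r : ℤ) : ℝ) * (T * L) := by
    rw [hnR]
    push_cast
    ring
  rw [harg, invZak_apply (mul_pos hT hL) _ hmem, ← harg, fiberCoeff, ← integral_const_mul,
    ← integral_mul_const]
  refine integral_congr_ae (ae_of_all _ fun f => ?_)
  simp only [responseZak_apply c H p ht, rowFun, Finset.sum_mul, Finset.mul_sum]
  refine Finset.sum_congr rfl fun i _ => ?_
  have hc : c (((i.1 : ℕ) : ZMod L) - (n : ZMod L))
      = c (((i.1 : ℕ) : ZMod L) - ((p : ℕ) : ZMod L)) := by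
    rw [hn]
    push_cast
    simp
  have htone : tone (f + (corner T L i).2) (n * T)
      = tone (p * T) f * tone (-((-r : ℤ) * (T * L))) f * tone ((i.2 : ℝ) / (T * L)) (n * T) := by
    rw [← tone_add, tone_add, tone_comm f]
    congr 2
    rw [hnR]
    push_cast
    ring
  simp only [contribution, trainMatrix, Matrix.of_apply]
  rw [hc, htone, tone_natCast_div hT i.2 n p r hn]
  -- The normalization of the Fourier coefficient cancels that of `trainMatrix`.
  have e : ((T * L : ℝ) : ℂ) * (1 / (T * L)) = 1 := by
    push_cast at hTL ⊢
    exact mul_one_div_cancel hTL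
  linear_combination (c (((i.1 : ℕ) : ZMod L) - ((p : ℕ) : ZMod L)) *
    cellComponent T L H i (t, f) * tone (p * T) f * tone (-((-r : ℤ) * (T * L))) f *
    tone ((i.2 : ℝ) / (T * L)) (n * T) * φ (t + n * T)) * e

/-- The response to a Dirac train, its Zak transform and its norm. -/
theorem exists_response (hT : 0 < T) [NeZero L] (c : ZMod L → ℂ) {H : Op}
    {Γ : Finset (Fin L × Fin L)} (hH : H ∈ opClass T L Γ) :
    ∃ y : Lp ℂ 2 (volume : Measure ℝ), IsResponse H (diracTrain T c) y ∧
      IsZakTransform (T * L) y (responseZak T c H) ∧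
      ‖y‖ ^ 2 = T * L * ∑ p, ‖∑ i, trainMatrix T c p i • cellMap T L i H‖ ^ 2 := by
  have hL : (0 : ℝ) < L := by exact_mod_cast NeZero.pos L
  have hP : 0 < T * L := mul_pos hT hL
  have hmeas := measurable_responseZak (T := T) c H
  have hG2 : MemLp (responseZak T c H) 2
      (volume.restrict (Set.Ico 0 (T * L) ×ˢ Set.Ico 0 (1 / (T * L)))) := by
    refine memLp_two_of_lintegral hmeas.aestronglyMeasurable ?_
    rw [lintegral_responseZak hT]
    exact ENNReal.sum_lt_top.2 fun p _ => by simp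
  -- The candidate is built by inverting the Zak transform; that it represents the weak integral is
  -- checked afterwards.
  obtain ⟨y, hy, hzak, hnorm⟩ := exists_isZakTransform hP hmeas hG2
  refine ⟨y, fun φ => ?_, hzak, ?_⟩
  swap
  · rw [lintegral_responseZak hT] at hnorm
    have h := congrArg ENNReal.toReal hnorm
    rw [ENNReal.toReal_mul, ENNReal.toReal_sum fun i _ => by simp,
      ENNReal.toReal_ofReal hP.le] at h
    simpa using h
  -- All `L ^ 2` cells are kept, since `rowFun` sums over all of them; the inactive ones add zero.
  have hH' := opClass_mono (Finset.subset_univ Γ) hH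
  have hzero : ∀ᵐ p : ℝ × ℝ, p ∉ region T L Finset.univ →
      H p * modulation p.2 (translation p.1 (diracTrain T c)) φ = 0 := by
    have h1 : ∀ᵐ p : ℝ × ℝ, p ∉ region T L Finset.univ → H p = 0 := hH'
    filter_upwards [h1] with p hp hp'
    rw [hp hp', zero_mul]
  have hcell := hasSum_integral_contribution hT c H φ
  have hreg : region T L Finset.univ
      = ⋃ i ∈ (Finset.univ : Finset (Fin L × Fin L)), corner T L i +ᵥ cell T L := rfl
  have hint : IntegrableOn
      (fun p : ℝ × ℝ => H p * modulation p.2 (translation p.1 (diracTrain T c)) φ)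
      (region T L Finset.univ) := by
    rw [hreg, integrableOn_finset_iUnion]
    exact fun i _ => (hcell i).1
  refine ⟨hint.integrable_of_ae_notMem_eq_zero hzero, ?_⟩
  rw [← setIntegral_eq_integral_of_ae_compl_eq_zero hzero, hreg,
    integral_biUnion_finset _ (fun _ _ => measurableSet_cell_vadd _)
      (pairwise_disjoint_cells _) (fun i _ => (hcell i).1)]
  -- Both sides become series over the periods `n`, which agree term by term after Fubini on the
  -- cell.
  have hR := hasSum_sum fun i (_ : i ∈ Finset.univ) => (hcell i).2
  have hLsum := hasSum_integral_translates hT (integrable_lp_mul_schwartz y φ)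
  refine hLsum.unique (hR.congr_fun fun n => ?_)
  have hci : ∀ i, IntegrableOn (contribution T c H φ n i) (cell T L) (volume.prod volume) :=
    fun i => integrableOn_contribution hT c H φ n i
  rw [← integral_finsetSum _ fun i _ => integrableOn_contribution hT c H φ n i, cell,
    Measure.volume_eq_prod, setIntegral_prod _ (integrable_finsetSum _ fun i _ => hci i)]
  refine setIntegral_congr_ae measurableSet_Ico ?_
  filter_upwards [(measurePreserving_add_right (volume : Measure ℝ)
    (n * T)).quasiMeasurePreserving.ae hy] with t h1 ht
  rw [h1, invZak_responseZak hT c H φ n ht]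

/-- At almost every point of the fundamental cell, the vector of values of a Zak transform of the
response is `A_c s`. -/
theorem zakVector_ae_eq (hT : 0 < T) [NeZero L] (c : ZMod L → ℂ) {H : Op}
    {y : Lp ℂ 2 (volume : Measure ℝ)} (hy : IsZakTransform (T * L) y (responseZak T c H))
    {ζ : ℝ × ℝ → ℂ} (hζ : IsZakTransform (T * L) y ζ) :
    ∀ᵐ u ∂(volume.restrict (cell T L)), zakVector T L ζ u = fun p => rowFun T c H p u := by
  have h := (ae_restrict_iff' (measurableSet_Ico.prod measurableSet_Ico)).1 (hζ.ae_eq hy)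
  have h1 : ∀ᵐ u ∂(volume.restrict (cell T L)), ∀ p : Fin L,
      zakVector T L ζ u p = rowFun T c H p u := by
    refine eventually_all.2 fun p => ?_
    filter_upwards [ae_restrict_mem measurableSet_cell,
      ae_restrict_of_ae ((measurePreserving_add_row (T := T) p).quasiMeasurePreserving.ae h)]
      with u hu hu'
    have e : u + ((p : ℝ) * T, 0) = (u.1 + p * T, u.2) := by ext <;> simp
    rw [e] at hu'
    have hpL : ((p : ℕ) : ℝ) + 1 ≤ L := by exact_mod_cast p.2
    have hmem : (u.1 + p * T, u.2) ∈ Set.Ico 0 (T * L) ×ˢ Set.Ico 0 (1 / (T * L)) := by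
      refine ⟨⟨?_, ?_⟩, hu.2⟩
      · have := hu.1.1
        positivity
      · have := hu.1.2
        change u.1 + p * T < T * L
        nlinarith
    unfold zakVector
    rw [hu' hmem, responseZak_apply c H p hu.1, mul_assoc, ← tone_add]
    simp [tone_zero]
  filter_upwards [h1] with u hu
  exact funext hu

/-! ### Stability -/

/-- The map `H ↦ A_c s`, where `s` is the vector of the components of `H`. -/
def zakMap (T : ℝ) {L : ℕ} (c : ZMod L → ℂ) :
    Op →L[ℂ] (Fin L → Lp ℂ 2 (volume.restrict (cell T L))) :=
  ContinuousLinearMap.pi fun p => ∑ i, trainMatrix T c p i • cellMap T L i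

theorem zakMap_apply (c : ZMod L → ℂ) (H : Op) (p : Fin L) :
    zakMap T c H p = ∑ i, trainMatrix T c p i • cellMap T L i H := by
  simp [zakMap]

/-- A functional on `ℂ^L` sees only its values on the active columns. Prescribing these values
isolates components or annihilates a whole support set. -/
theorem sum_smul_zakMap (c : ZMod L → ℂ) {H : Op} {Γ : Finset (Fin L × Fin L)}
    (hH : H ∈ opClass T L Γ) (v : Fin L → ℂ) :
    ∑ p, v p • zakMap T c H p
      = ∑ i ∈ Γ, (∑ p, v p * trainMatrix T c p i) • cellMap T L i H := by
  simp only [zakMap_apply, Finset.smul_sum, smul_smul, Finset.sum_smul]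
  rw [Finset.sum_comm]
  symm
  refine Finset.sum_subset (Finset.subset_univ Γ) fun i _ hi => ?_
  simp [cellMap_eq_zero hH hi]

theorem norm_sum_smul_le {E ι : Type*} [NormedAddCommGroup E] [NormedSpace ℂ E] [Fintype ι]
    (v : ι → ℂ) (z : ι → E) : ‖∑ p, v p • z p‖ ≤ (∑ p, ‖v p‖) * ‖z‖ := by
  rw [Finset.sum_mul]
  refine (norm_sum_le _ _).trans (Finset.sum_le_sum fun p _ => ?_)
  rw [norm_smul]
  exact mul_le_mul_of_nonneg_left (norm_le_pi_norm z p) (norm_nonneg _)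

/-- The product carries the sup norm, whereas Plancherel gives the sum of `L` squares; hence the
extra factor `L` in the upper bound. -/
theorem response_bounds (hT : 0 < T) [NeZero L] (c : ZMod L → ℂ) {H : Op}
    {Γ : Finset (Fin L × Fin L)} (hH : H ∈ opClass T L Γ) {y : Lp ℂ 2 (volume : Measure ℝ)}
    (hy : IsResponse H (diracTrain T c) y) :
    √(T * L) * ‖zakMap T c H‖ ≤ ‖y‖ ∧ ‖y‖ ≤ √(T * L * L) * ‖zakMap T c H‖ := by
  have hL : (0 : ℝ) < L := by exact_mod_cast NeZero.pos L
  obtain ⟨y', hy', -, hnorm⟩ := exists_response hT c hH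
  rw [hy'.unique hy] at hnorm
  simp only [← zakMap_apply] at hnorm
  constructor
  · rw [← Real.sqrt_sq (norm_nonneg y), ← le_div_iff₀' (Real.sqrt_pos.2 (by positivity)),
      pi_norm_le_iff_of_nonneg (by positivity)]
    intro p
    rw [le_div_iff₀' (Real.sqrt_pos.2 (by positivity)), ← Real.sqrt_sq (norm_nonneg (_ : Lp ℂ 2 _)),
      ← Real.sqrt_mul (by positivity), hnorm]
    refine Real.sqrt_le_sqrt (mul_le_mul_of_nonneg_left ?_ (by positivity))
    exact Finset.single_le_sum (f := fun p => ‖zakMap T c H p‖ ^ 2)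
      (fun _ _ => by positivity) (Finset.mem_univ p)
  · rw [← Real.sqrt_sq (norm_nonneg y), ← Real.sqrt_sq (norm_nonneg (zakMap T c H)),
      ← Real.sqrt_mul (by positivity), hnorm, mul_assoc (T * L)]
    refine Real.sqrt_le_sqrt (mul_le_mul_of_nonneg_left ?_ (by positivity))
    refine (Finset.sum_le_sum fun p _ => pow_le_pow_left₀ (norm_nonneg _)
      (norm_le_pi_norm (zakMap T c H) p) 2).trans ?_
    simp

/-- An upper bound for the norms of the responses, valid for all operators. -/
def upperBound (T : ℝ) {L : ℕ} (c : ZMod L → ℂ) : ℝ := max 1 (√(T * L * L) * ‖zakMap T c‖)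

/-- The difference lies in the class of the union of the supports, where the norm formula for the
response holds without a bound on the number of cells. Stability thus reduces to a lower bound for
`zakMap`. -/
theorem stabilityBounds_of_le (hT : 0 < T) [NeZero L] (c : ZMod L → ℂ) {H₁ H₂ : Op}
    {Γ₁ Γ₂ : Finset (Fin L × Fin L)} (h₁ : H₁ ∈ opClass T L Γ₁) (h₂ : H₂ ∈ opClass T L Γ₂)
    {W : ℝ} (hW : 0 < W) (h : ‖H₁ - H₂‖ ≤ W * ‖zakMap T c (H₁ - H₂)‖) :
    StabilityBounds (diracTrain T c) (√(T * L) / W) (upperBound T c) H₁ H₂ := by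
  classical
  have hL : (0 : ℝ) < L := by exact_mod_cast NeZero.pos L
  obtain ⟨y₁, hy₁, -, -⟩ := exists_response hT c h₁
  obtain ⟨y₂, hy₂, -, -⟩ := exists_response hT c h₂
  have hmem : H₁ - H₂ ∈ opClass T L (Γ₁ ∪ Γ₂) :=
    Submodule.sub_mem _ (opClass_mono Finset.subset_union_left h₁)
      (opClass_mono Finset.subset_union_right h₂)
  obtain ⟨hlow, hup⟩ := response_bounds hT c hmem (hy₁.sub hy₂)
  refine ⟨y₁, y₂, hy₁, hy₂, le_trans ?_ hlow, hup.trans ?_⟩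
  · rw [div_mul_eq_mul_div, mul_div_assoc]
    refine mul_le_mul_of_nonneg_left ?_ (Real.sqrt_nonneg _)
    rwa [div_le_iff₀' hW]
  · calc √(T * L * L) * ‖zakMap T c (H₁ - H₂)‖
        ≤ √(T * L * L) * (‖zakMap T c‖ * ‖H₁ - H₂‖) := by
          gcongr
          exact (zakMap T c).le_opNorm _
      _ = √(T * L * L) * ‖zakMap T c‖ * ‖H₁ - H₂‖ := by ring
      _ ≤ upperBound T c * ‖H₁ - H₂‖ := by
          gcongr
          exact le_max_right _ _

theorem StabilityBounds.mono {x : 𝓢'(ℝ, ℂ)} {α α' β : ℝ} {H₁ H₂ : Op}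
    (h : StabilityBounds x α β H₁ H₂) (hα : α' ≤ α) : StabilityBounds x α' β H₁ H₂ := by
  obtain ⟨y₁, y₂, h₁, h₂, h₃, h₄⟩ := h
  exact ⟨y₁, y₂, h₁, h₂, (mul_le_mul_of_nonneg_right hα (norm_nonneg _)).trans h₃, h₄⟩

/-- If the columns of `A_c` with index in `Λ` are linearly independent, a linear functional can
take prescribed values on them. -/
theorem exists_functional {c : ZMod L → ℂ} {Λ : Finset (Fin L × Fin L)}
    (hc : LinearIndependent ℂ fun i : Λ => (trainMatrix T c).col i.1)
    (w : Fin L × Fin L → ℂ) : ∃ v : Fin L → ℂ, ∀ i ∈ Λ, ∑ p, v p * trainMatrix T c p i = w i := by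
  classical
  obtain ⟨g, hg⟩ := LinearMap.exists_extend
    ((Module.Basis.span hc).constr ℂ fun i : Λ => w i.1)
  refine ⟨fun p => g (Pi.single p 1), fun i hi => ?_⟩
  have h1 := LinearMap.congr_fun hg (Module.Basis.span hc ⟨i, hi⟩)
  rw [Module.Basis.constr_basis, LinearMap.comp_apply, Submodule.subtype_apply,
    Module.Basis.span_apply] at h1
  have h2 : g ((trainMatrix T c).col i) = w i := h1
  rw [← h2]
  conv_rhs => rw [pi_eq_sum_univ' ((trainMatrix T c).col i), map_sum]
  refine Finset.sum_congr rfl fun p _ => ?_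
  rw [map_smul, smul_eq_mul, mul_comm, Matrix.col_apply]

/-- On the operators with a known support set of at most `L` cells, `H ↦ A_c s` is bounded
below. -/
theorem exists_norm_le_zakMap {c : ZMod L → ℂ} {Γ : Finset (Fin L × Fin L)}
    (hc : LinearIndependent ℂ fun i : Γ => (trainMatrix T c).col i.1) :
    ∃ V : ℝ, 0 < V ∧ ∀ H ∈ opClass T L Γ, ‖H‖ ≤ V * ‖zakMap T c H‖ := by
  classical
  choose v hv using fun i : Fin L × Fin L => exists_functional hc (Pi.single i 1)
  let S : ℝ := ∑ i ∈ Γ, (∑ p, ‖v i p‖) ^ 2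
  have hS : 0 ≤ S := Finset.sum_nonneg fun i _ => by positivity
  -- The added one keeps the constant positive when `Γ` is empty.
  refine ⟨√S + 1, by positivity, fun H hH => ?_⟩
  -- The functional dual to column `i` extracts component `i` from the Zak data.
  have hcomp : ∀ i ∈ Γ, ‖cellMap T L i H‖ ≤ (∑ p, ‖v i p‖) * ‖zakMap T c H‖ := by
    intro i hi
    have h1 := sum_smul_zakMap c hH (v i)
    rw [Finset.sum_eq_single_of_mem i hi, hv i i hi, Pi.single_eq_same, one_smul] at h1
    · rw [← h1]
      exact norm_sum_smul_le _ _
    · intro j hj hji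
      rw [hv i j hj, Pi.single_eq_of_ne hji, zero_smul]
  have hsq : ‖H‖ ^ 2 ≤ S * ‖zakMap T c H‖ ^ 2 := by
    rw [norm_sq_eq_sum_cellMap hH, Finset.sum_mul]
    refine Finset.sum_le_sum fun i hi => ?_
    rw [← mul_pow]
    exact pow_le_pow_left₀ (norm_nonneg _) (hcomp i hi) 2
  have h2 : ‖H‖ ≤ √S * ‖zakMap T c H‖ := by
    rw [← Real.sqrt_sq (norm_nonneg H), ← Real.sqrt_sq (norm_nonneg (zakMap T c H)),
      ← Real.sqrt_mul hS]
    exact Real.sqrt_le_sqrt hsq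
  nlinarith [norm_nonneg (zakMap T c H)]

/-- An operator with linearly independent components is separated from all the operators with
another support set. -/
theorem exists_norm_sub_le_zakMap {c : ZMod L → ℂ}
    (hc : ∀ Λ : Finset (Fin L × Fin L), Λ.card ≤ L →
      LinearIndependent ℂ fun i : Λ => (trainMatrix T c).col i.1)
    {Γ Γ' : Finset (Fin L × Fin L)} (hΓ' : Γ'.card < L)
    {H : Op} (hH : H ∈ opClass T L Γ) (hind : CellsIndependent T L Γ H) :
    ∃ W : ℝ, 0 < W ∧ ∀ H' ∈ opClass T L Γ', ‖H - H'‖ ≤ W * ‖zakMap T c (H - H')‖ := by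
  classical
  obtain ⟨V, hV, hlow⟩ := exists_norm_le_zakMap (hc Γ' hΓ'.le)
  -- If `Γ'` contains `Γ`, the difference is supported on `Γ'` and the bound for known support
  -- applies.
  by_cases hsub : Γ ⊆ Γ'
  · exact ⟨V, hV, fun H' hH' => hlow _ (Submodule.sub_mem _ (opClass_mono hsub hH) hH')⟩
  obtain ⟨j, hj, hj'⟩ := Finset.not_subset.1 hsub
  -- The strict bound on `Γ'.card` allows the extra column `j`.
  obtain ⟨v, hv⟩ := exists_functional
    (hc (insert j Γ') ((Finset.card_insert_le _ _).trans hΓ')) (Pi.single j 1)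
  -- As `v` annihilates the data of every `H'`, this vector is the same for `H` and `H - H'`. It is
  -- not zero, because component `j` of `H` enters with coefficient one.
  let e := ∑ p, v p • zakMap T c H p
  have he : e ≠ 0 := by
    intro h0
    have h1 := linearIndepOn_finset_iff.1
      (show LinearIndepOn ℂ (fun i => cellMap T L i H) (Γ : Set (Fin L × Fin L)) from
        cellsIndependent_iff.1 hind) _ ((sum_smul_zakMap c hH v).symm.trans h0) j hj
    rw [hv j (Finset.mem_insert_self _ _), Pi.single_eq_same] at h1
    exact one_ne_zero h1
  have he' : 0 < ‖e‖ := norm_pos_iff.2 he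
  -- Bounding `‖H'‖` by its data leaves the constant `‖H‖ + V * ‖zakMap T c H‖`. It is absorbed by a
  -- quantity that is at least one and linear in the distance of the data.
  refine ⟨(‖H‖ + V * ‖zakMap T c H‖) * (∑ p, ‖v p‖) / ‖e‖ + V, by positivity, fun H' hH' => ?_⟩
  have h1 : ‖e‖ ≤ (∑ p, ‖v p‖) * ‖zakMap T c (H - H')‖ := by
    have h2 : e = ∑ p, v p • zakMap T c (H - H') p := by
      simp only [map_sub, Pi.sub_apply, smul_sub, Finset.sum_sub_distrib]
      rw [sum_smul_zakMap c hH', Finset.sum_eq_zero (s := Γ'), sub_zero]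
      intro i hi
      rw [hv i (Finset.mem_insert_of_mem hi),
        Pi.single_eq_of_ne (by rintro rfl; exact hj' hi), zero_smul]
    rw [h2]
    exact norm_sum_smul_le _ _
  have h3 : ‖H'‖ ≤ V * (‖zakMap T c (H - H')‖ + ‖zakMap T c H‖) := by
    refine (hlow H' hH').trans (mul_le_mul_of_nonneg_left ?_ hV.le)
    have : zakMap T c H' = zakMap T c H - zakMap T c (H - H') := by rw [map_sub]; abel
    rw [this]
    exact (norm_sub_le _ _).trans (by rw [add_comm])
  have h4 : 1 ≤ (∑ p, ‖v p‖) / ‖e‖ * ‖zakMap T c (H - H')‖ := by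
    rw [div_mul_eq_mul_div, le_div_iff₀ he', one_mul]
    exact h1
  have h5 : 0 ≤ ‖H‖ + V * ‖zakMap T c H‖ := by positivity
  calc ‖H - H'‖ ≤ ‖H‖ + ‖H'‖ := norm_sub_le _ _
    _ ≤ (‖H‖ + V * ‖zakMap T c H‖) * 1 + V * ‖zakMap T c (H - H')‖ := by linarith
    _ ≤ (‖H‖ + V * ‖zakMap T c H‖) * ((∑ p, ‖v p‖) / ‖e‖ * ‖zakMap T c (H - H')‖)
        + V * ‖zakMap T c (H - H')‖ := by gcongr
    _ = _ := by ring

theorem mem_blindClass {Δ : ℝ} {H : Op} :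
    H ∈ blindClass T L Δ ↔ ∃ Γ : Finset (Fin L × Fin L), area T L Γ ≤ Δ ∧ H ∈ opClass T L Γ := by
  simp [blindClass]

/-- There are finitely many competing supports; the sum of their positive constants serves as a
common bound, with the default one for supports that are too large. -/
theorem exists_stabilityBounds (hT : 0 < T) [NeZero L] {Δ : ℝ} (hΔ : Δ < 1) {c : ZMod L → ℂ}
    (hc : ∀ Λ : Finset (Fin L × Fin L), Λ.card ≤ L →
      LinearIndependent ℂ fun i : Λ => (trainMatrix T c).col i.1)
    {Γ : Finset (Fin L × Fin L)} {H : Op} (hH : H ∈ opClass T L Γ)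
    (hind : CellsIndependent T L Γ H) :
    ∃ α : ℝ, 0 < α ∧ ∀ H' ∈ blindClass T L Δ,
      StabilityBounds (diracTrain T c) α (upperBound T c) H H' := by
  have hL : (0 : ℝ) < L := by exact_mod_cast NeZero.pos L
  have hex : ∀ Γ' : Finset (Fin L × Fin L), ∃ W : ℝ, 0 < W ∧ (area T L Γ' ≤ Δ →
      ∀ H' ∈ opClass T L Γ', ‖H - H'‖ ≤ W * ‖zakMap T c (H - H')‖) := by
    intro Γ'
    by_cases hΓ' : area T L Γ' ≤ Δ
    · obtain ⟨W, hW, h⟩ := exists_norm_sub_le_zakMap hc (card_lt_of_area_le hT hΔ hΓ') hH hind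
      exact ⟨W, hW, fun _ => h⟩
    · exact ⟨1, one_pos, fun h => absurd h hΓ'⟩
  choose W hW hbound using hex
  have hpos : 0 < ∑ Γ', W Γ' := Finset.sum_pos (fun Γ' _ => hW Γ') Finset.univ_nonempty
  refine ⟨√(T * L) / ∑ Γ', W Γ', by positivity, fun H' hH' => ?_⟩
  obtain ⟨Γ', hΓ', hH'⟩ := mem_blindClass.1 hH'
  refine stabilityBounds_of_le hT c hH hH' hpos ((hbound Γ' hΓ' H' hH').trans ?_)
  refine mul_le_mul_of_nonneg_right ?_ (norm_nonneg _)
  exact Finset.single_le_sum (fun Γ' _ => (hW Γ').le) (Finset.mem_univ Γ')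

/-- Lowering `α` to at most one secures `α ≤ β`, since `β` is at least one. -/
theorem stablyIdentifies_of_forall {x : 𝓢'(ℝ, ℂ)} {Q : Set Op} {α β : ℝ} (hα : 0 < α)
    (hβ : 1 ≤ β) (h : ∀ H₁ ∈ Q, ∀ H₂ ∈ Q, StabilityBounds x α β H₁ H₂) :
    StablyIdentifies x Q :=
  ⟨min α 1, β, lt_min hα one_pos, (min_le_right _ _).trans hβ,
    fun H₁ h₁ H₂ h₂ => (h H₁ h₁ H₂ h₂).mono (min_le_left _ _)⟩

theorem stablyIdentifiesIn_of_forall {x : 𝓢'(ℝ, ℂ)} {Q : Set Op} {H : Op} {α β : ℝ}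
    (hα : 0 < α) (hβ : 1 ≤ β) (h : ∀ H' ∈ Q, StabilityBounds x α β H H') :
    StablyIdentifiesIn x Q H :=
  ⟨min α 1, β, lt_min hα one_pos, (min_le_right _ _).trans hβ,
    fun H' h' => (h H' h').mono (min_le_left _ _)⟩

/-! ### Recovery -/

/-- The correlation matrix is a Gram matrix; the indices are swapped because the inner product is
conjugate linear in its first argument. -/
theorem correlationMatrix_apply {c : ZMod L → ℂ} {H : Op} {ζ : ℝ × ℝ → ℂ}
    (hζ : ∀ᵐ u ∂(volume.restrict (cell T L)), zakVector T L ζ u = fun p => rowFun T c H p u)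
    (p q : Fin L) :
    correlationMatrix T L ζ p q = inner ℂ (zakMap T c H q) (zakMap T c H p) := by
  rw [L2.inner_def, correlationMatrix, Matrix.of_apply, zakMap_apply, zakMap_apply]
  refine integral_congr_ae ?_
  filter_upwards [hζ, coeFn_sum_cellMap c H p, coeFn_sum_cellMap c H q] with u h1 h2 h3
  rw [h1, h2, h3, RCLike.inner_apply]

/-- A Gram matrix kills `v` exactly when the corresponding combination `e` of the data vanishes. The
independent components then force every coefficient of `e` to be zero, so the null space is the
orthogonal complement of the active columns. -/
theorem mulVec_correlationMatrix_eq_zero_iff {c : ZMod L → ℂ} {Γ : Finset (Fin L × Fin L)}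
    {H : Op} (hH : H ∈ opClass T L Γ) (hind : CellsIndependent T L Γ H) {ζ : ℝ × ℝ → ℂ}
    (hζ : ∀ᵐ u ∂(volume.restrict (cell T L)), zakVector T L ζ u = fun p => rowFun T c H p u)
    (v : Fin L → ℂ) :
    correlationMatrix T L ζ *ᵥ v = 0 ↔
      ∀ i ∈ Γ, ∑ p, conj (v p) * trainMatrix T c p i = 0 := by
  let e := ∑ q, conj (v q) • zakMap T c H q
  have hZ : ∀ p, (correlationMatrix T L ζ *ᵥ v) p = inner ℂ e (zakMap T c H p) := by
    intro p
    simp only [Matrix.mulVec, dotProduct, correlationMatrix_apply hζ, e, sum_inner,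
      inner_smul_left, Complex.conj_conj]
    exact Finset.sum_congr rfl fun q _ => mul_comm _ _
  have h1 : correlationMatrix T L ζ *ᵥ v = 0 ↔ e = 0 := by
    constructor
    · intro h
      rw [← inner_self_eq_zero (𝕜 := ℂ)]
      change inner ℂ e (∑ q, conj (v q) • zakMap T c H q) = 0
      simp only [inner_sum, inner_smul_right, ← hZ, h, Pi.zero_apply, mul_zero,
        Finset.sum_const_zero]
    · intro h
      funext p
      rw [hZ, h, inner_zero_left, Pi.zero_apply]
  rw [h1]
  change ∑ q, conj (v q) • zakMap T c H q = 0 ↔ _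
  rw [sum_smul_zakMap c hH fun q => conj (v q)]
  constructor
  · exact linearIndepOn_finset_iff.1
      (show LinearIndepOn ℂ (fun i => cellMap T L i H) (Γ : Set (Fin L × Fin L)) from
        cellsIndependent_iff.1 hind) _
  · exact fun h => Finset.sum_eq_zero fun i hi => by rw [h i hi, zero_smul]

/-- The zero columns are those in the span of the active ones. No inactive column lies there, as it
forms with the active ones a set of at most `L` columns. -/
theorem supportRecovered {c : ZMod L → ℂ}
    (hc : ∀ Λ : Finset (Fin L × Fin L), Λ.card ≤ L →
      LinearIndependent ℂ fun i : Λ => (trainMatrix T c).col i.1)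
    {Γ : Finset (Fin L × Fin L)} (hΓ : Γ.card < L) {H : Op} (hH : H ∈ opClass T L Γ)
    (hind : CellsIndependent T L Γ H) {ζ : ℝ × ℝ → ℂ}
    (hζ : ∀ᵐ u ∂(volume.restrict (cell T L)), zakVector T L ζ u = fun p => rowFun T c H p u) :
    SupportRecovered T c ζ Γ := by
  classical
  intro r Un hUn i
  have hker := mulVec_correlationMatrix_eq_zero_iff hH hind hζ
  -- Orthogonality to the columns of `Un` passes to their span, so only the null space matters, not
  -- the choice of `Un`.
  have hcol : (Unᴴ * trainMatrix T c).col i = 0 ↔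
      ∀ v ∈ Submodule.span ℂ (Set.range Un.col), ∑ p, conj (v p) * trainMatrix T c p i = 0 := by
    constructor
    · intro h v hv
      induction hv using Submodule.span_induction with
      | mem x hx =>
        obtain ⟨j, rfl⟩ := hx
        simpa [Matrix.mul_apply] using congrFun h j
      | zero => simp
      | add x y _ _ hx hy =>
        simp only [Pi.add_apply, map_add, add_mul, Finset.sum_add_distrib, hx, hy, add_zero]
      | smul a x _ hx =>
        simp only [Pi.smul_apply, smul_eq_mul, map_mul, mul_assoc, ← Finset.mul_sum, hx, mul_zero]
    · intro h
      funext j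
      simpa [Matrix.mul_apply] using h (Un.col j) (Submodule.subset_span ⟨j, rfl⟩)
  rw [hcol, hUn]
  simp only [LinearMap.mem_ker, Matrix.mulVecLin_apply, hker]
  constructor
  · intro h
    by_contra hi
    -- Its conjugate lies in the null space but is not orthogonal to column `i`.
    obtain ⟨v, hv⟩ := exists_functional
      (hc (insert i Γ) ((Finset.card_insert_le _ _).trans hΓ)) (Pi.single i 1)
    have h1 := h (fun p => conj (v p)) (by
      intro j hj
      simp only [Complex.conj_conj]
      rw [hv j (Finset.mem_insert_of_mem hj),
        Pi.single_eq_of_ne (by rintro rfl; exact hi hj)])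
    simp only [Complex.conj_conj] at h1
    rw [hv i (Finset.mem_insert_self _ _), Pi.single_eq_same] at h1
    exact one_ne_zero h1
  · exact fun hi v hv => hv i hi

/-- Inactive components vanish almost everywhere, so `z = A_c s` reduces to `A_Γ`, which is
injective by the independence of its columns. -/
theorem spreadingRecovered {c : ZMod L → ℂ} {Γ : Finset (Fin L × Fin L)}
    (hc : LinearIndependent ℂ fun i : Γ => (trainMatrix T c).col i.1)
    {H : Op} (hH : H ∈ opClass T L Γ) {ζ : ℝ × ℝ → ℂ}
    (hζ : ∀ᵐ u ∂(volume.restrict (cell T L)), zakVector T L ζ u = fun p => rowFun T c H p u) :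
    SpreadingRecovered T c ζ Γ H := by
  classical
  have hcol : LinearIndependent ℂ (activeMatrix T c Γ).col := hc
  have hinj : Function.Injective (activeMatrix T c Γ).mulVec :=
    Matrix.mulVec_injective_iff.2 hcol
  refine ⟨?_, ?_⟩
  · have h := LinearIndependent.rank_matrix (M := (activeMatrix T c Γ)ᵀ) hcol
    rw [Matrix.rank_transpose] at h
    simpa using h
  · have hzero : ∀ᵐ u ∂(volume.restrict (cell T L)), ∀ i, i ∉ Γ → cellComponent T L H i u = 0 := by
      refine eventually_all.2 fun i => ?_
      by_cases hi : i ∈ Γ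
      · exact Eventually.of_forall fun u h => absurd hi h
      · have h1 := coeFn_cellMap (T := T) H i
        rw [cellMap_eq_zero hH hi] at h1
        filter_upwards [h1, Lp.coeFn_zero ℂ 2 (volume.restrict (cell T L))] with u h2 h3 _
        rw [← h2, h3, Pi.zero_apply]
    filter_upwards [hζ, hzero] with u h1 h2 v
    have h3 : activeMatrix T c Γ *ᵥ (fun i : Γ => cellComponent T L H i.1 u)
        = zakVector T L ζ u := by
      rw [h1]
      funext p
      simp only [Matrix.mulVec, dotProduct, activeMatrix, Matrix.submatrix_apply, id, rowFun]
      rw [Finset.sum_coe_sort Γ fun i => trainMatrix T c p i * cellComponent T L H i u]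
      exact Finset.sum_subset (Finset.subset_univ Γ) fun i _ hi => by rw [h2 i hi, mul_zero]
    rw [← h3]
    exact hinj.eq_iff

end OperatorId

end

/-! ### The theorem -/

theorem theorem3 (T : ℝ) (hT : 0 < T) (L : ℕ) [NeZero L] (Δ : ℝ) (hΔ : Δ < 1) :
    ∃ c : ZMod L → ℂ,
      -- almost every operator in `X(Δ)` is stably identified among all operators in `X(Δ)`
      AlmostAll T L Δ {H | StablyIdentifiesIn (diracTrain T c) (blindClass T L Δ) H} ∧
      -- almost all of `X(Δ)` is exhausted by sets that are stably identified
      (∃ Q : ℕ → Set Op, Monotone Q ∧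
        (∀ n, Q n ⊆ blindClass T L Δ ∧ StablyIdentifies (diracTrain T c) (Q n)) ∧
        AlmostAll T L Δ (⋃ n, Q n)) ∧
      -- every class with known support region is stably identified as a whole
      (∀ Γ : Finset (Fin L × Fin L), area T L Γ ≤ Δ →
        StablyIdentifies (diracTrain T c) (opClass T L Γ : Set Op)) ∧
      -- almost all operators in `X(Δ)` have linearly independent active components
      AlmostAll T L Δ {H | ∃ Γ : Finset (Fin L × Fin L), area T L Γ ≤ Δ ∧
        H ∈ opClass T L Γ ∧ CellsIndependent T L Γ H} ∧
      -- and these are the operators that the algorithm recovers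
      (∀ Γ : Finset (Fin L × Fin L), area T L Γ ≤ Δ → ∀ H ∈ opClass T L Γ,
        CellsIndependent T L Γ H →
          StablyIdentifiesIn (diracTrain T c) (blindClass T L Δ) H ∧
          ∀ y : Lp ℂ 2 (volume : Measure ℝ), IsResponse H (diracTrain T c) y →
            (∃ ζ, IsZakTransform (T * L) y ζ) ∧
            ∀ ζ, IsZakTransform (T * L) y ζ →
              SupportRecovered T c ζ Γ ∧ SpreadingRecovered T c ζ Γ H) := by
  obtain ⟨c, hc⟩ := exists_trainMatrix_linearIndependent hT L
  have hL : (0 : ℝ) < L := by exact_mod_cast NeZero.pos L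
  have hβ : 1 ≤ upperBound T c := le_max_left _ _
  have hall := almostAll_cellsIndependent (L := L) hT Δ
  refine ⟨c, ?_, ?_, ?_, hall, ?_⟩
  · refine almostAll_mono hall fun _ _ H _ ⟨Γ, _, hH, hind⟩ => ?_
    obtain ⟨α, hα, h⟩ := exists_stabilityBounds hT hΔ hc hH hind
    exact stablyIdentifiesIn_of_forall hα hβ h
  -- The set `Q n` asks for the lower constant `1 / (n + 1)` against all of `X(Δ)`, which covers
  -- pairs within `Q n` in particular. The upper constant does not depend on the operator, so every
  -- generic operator enters some `Q n`.
  · refine ⟨fun n => {H | H ∈ blindClass T L Δ ∧ ∀ H' ∈ blindClass T L Δ,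
      StabilityBounds (diracTrain T c) (1 / ((n : ℝ) + 1)) (upperBound T c) H H'}, ?_, ?_, ?_⟩
    · intro m n hmn H hH
      exact ⟨hH.1, fun H' hH' => (hH.2 H' hH').mono (Nat.one_div_le_one_div hmn)⟩
    · intro n
      exact ⟨fun H hH => hH.1, stablyIdentifies_of_forall Nat.one_div_pos_of_nat hβ
        fun H₁ h₁ H₂ h₂ => h₁.2 H₂ h₂.1⟩
    · refine almostAll_mono hall fun _ _ H _ ⟨Γ, hΓ, hH, hind⟩ => ?_
      obtain ⟨α, hα, h⟩ := exists_stabilityBounds hT hΔ hc hH hind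
      obtain ⟨n, hn⟩ := exists_nat_one_div_lt hα
      exact Set.mem_iUnion.2 ⟨n, mem_blindClass.2 ⟨Γ, hΓ, hH⟩,
        fun H' hH' => (h H' hH').mono hn.le⟩
  · intro Γ hΓ
    obtain ⟨V, hV, hlow⟩ := exists_norm_le_zakMap (hc Γ (card_lt_of_area_le hT hΔ hΓ).le)
    exact stablyIdentifies_of_forall (by positivity) hβ fun H₁ h₁ H₂ h₂ =>
      stabilityBounds_of_le hT c h₁ h₂ hV (hlow _ (Submodule.sub_mem _ h₁ h₂))
  · intro Γ hΓ H hH hind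
    have hcard := card_lt_of_area_le hT hΔ hΓ
    refine ⟨?_, fun y hy => ?_⟩
    · obtain ⟨α, hα, h⟩ := exists_stabilityBounds hT hΔ hc hH hind
      exact stablyIdentifiesIn_of_forall hα hβ h
    · obtain ⟨y', hy', hzak, -⟩ := exists_response hT c hH
      rw [hy'.unique hy] at hzak
      refine ⟨⟨_, hzak⟩, fun ζ hζ => ?_⟩
      have hae := zakVector_ae_eq hT c hzak hζ
      exact ⟨supportRecovered hc hcard hH hind hae,
        spreadingRecovered (hc Γ hcard.le) hH hae⟩
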